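/- Let $n,N\ge 1$, let $\mathcal G$ be an undirected, connected graph on the agents $\{1,\dots,n\}$ with degrees $d_i$ and neighbour sets $N_i$, and let $W=[w_{ij}]\in\mathbb R^{n\times n}$ be its lazy Metropolis matrix: $w_{ij}=\frac{1}{2\max(d_i,d_j)}$ if $i\ne j$ are adjacent, $w_{ii}=1-\sum_{q\in N_i}\frac{1}{2\max(d_i,d_q)}$, and $w_{ij}=0$ otherwise. Let $\sigma$ be the spectral norm of $W-\frac1n\mathbf 1\mathbf 1^T$, and let $U\ge n$ be a real number. Let $\beta>0$ and let $f_1,\dots,f_n:\mathbb R^N\to\mathbb R$ be convex and $\beta$-smooth (differentiable, with $\|\nabla f_i(x)-\nabla f_i(y)\|\le\beta\|x-y\|$ for all $x,y$). Put $f=\frac1n\sum_i f_i$ and assume that $f$ has a minimizer; let $x^*$ be any minimizer and $f^*=f(x^*)$. For a step size $\eta>0$ and arbitrary initial points $x_i(0)\in\mathbb R^N$, let $s_i(0)=\nabla f_i(x_i(0))$ and, for $t\ge0$, $$x_i(t+1)=\sum_{j}w_{ij}x_j(t)-\eta s_i(t),\qquad s_i(t+1)=\sum_j w_{ij}s_j(t)+\nabla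 f_i(x_i(t+1))-\nabla f_i(x_i(t)).$$ Let $x(t),s(t)\in\mathbb R^{n\times N}$ be the matrices with rows $x_i(t)$, $s_i(t)$; let $\bar x(t)=\frac1n\sum_i x_i(t)$, $g(t)=\frac1n\sum_i\nabla f_i(x_i(t))$ and $\hat x_i(t+1)=\frac1{t+1}\sum_{k=0}^t x_i(k+1)$, where vectors in $\mathbb R^N$ are row vectors. The norm $\|\cdot\|$ is the Euclidean norm of vectors and the Frobenius norm of matrices, $\mathbf 1$ is the all-one column vector of length $n$, and $\rho(\cdot)$ is the spectral radius. (a) Suppose in addition that $\alpha>0$ and that every $f_i$ is $\alpha$-strongly convex, i.e. $f_i(y)\ge f_i(x)+\langle\nabla f_i(x),y-x\rangle+\frac\alpha2\|y-x\|^2$ for all $x,y$. Let $\eta=\frac{\alpha}{\beta^2}\left(\frac1{426U^2}\right)^2$ and $$G(\eta)=\begin{bmatrix}\sigma+\beta\eta&\beta(\eta\beta+2)&\eta\beta^2\\ \eta&\sigma&0\\ 0&\eta\beta&\lambda\end{bmatrix},\qquad \lambda=\max(|1-\alpha\eta|,|1-\beta\eta|).$$ Then $\rho(G(\eta))\le 1-\frac12\left(\frac\alpha\beta\,\frac1{426U^2}\right)^2$,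 and, as $t\to\infty$, for every $i$ the quantities $\|\bar x(t)-x^*\|$, $\|x_i(t)-\bar x(t)\|$ and $\|s_i(t)-g(t)\|$ are $O(\rho(G(\eta))^t)$, and $f(x_i(t))-f^*$ is $O(\rho(G(\eta))^{2t})$. (b) Without strong convexity, let $0<\eta\le\frac{1}{160\beta(71U^2)^2}$. Then for every $t\ge0$ $$\frac1n\sum_{i=1}^n\big[f(\hat x_i(t+1))-f^*\big]\le\frac1{t+1}\left\{\frac{\|\bar x(0)-x^*\|^2}{2\eta}+\frac{36\beta}{(1-\sigma)^2}\Big[\frac{1}{\beta\sqrt n}\|s(0)-\mathbf 1g(0)\|+\frac{2}{\sqrt n}\|x(0)-\mathbf 1\bar x(0)\|\Big]^2\right\};$$ for every $t\ge1$ $$\min_{0\le k\le t}\|x(k)-\mathbf 1\bar x(k)\|^2\le\frac1t\left\{\frac{1740}{(1-\sigma)^4}\Big[\frac1\beta\|s(0)-\mathbf 1g(0)\|+2\|x(0)-\mathbf 1\bar x(0)\|\Big]^2+\frac{24}{(1-\sigma)^2}\|\mathbf 1\bar x(0)-\mathbf 1x^*\|^2\right\};$$ and for every $t\ge0$ and every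 $i$ $$f(\hat x_i(t+1))-f^*\le\frac1{t+1}\left\{\frac{\|\mathbf 1\bar x(0)-\mathbf 1x^*\|^2}{2\eta}+\frac{36\beta}{(1-\sigma)^2}\Big[\frac1\beta\|s(0)-\mathbf 1g(0)\|+2\|x(0)-\mathbf 1\bar x(0)\|\Big]^2\right\}.$$ -/

import Mathlib

open Set Filter Asymptotics

noncomputable section

namespace DistOpt

variable {n N : ℕ}

/-- A function is `β`-smooth if it is differentiable with a `β`-Lipschitz gradient. -/
def IsSmooth (β : ℝ) (ξ : EuclideanSpace ℝ (Fin N) → ℝ) : Prop :=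
  Differentiable ℝ ξ ∧ ∀ x y, ‖gradient ξ x - gradient ξ y‖ ≤ β * ‖x - y‖

/-- `α`-strong convexity, through the gradient inequality. It is only used for
differentiable functions. -/
def IsStronglyConvex (α : ℝ) (ξ : EuclideanSpace ℝ (Fin N) → ℝ) : Prop :=
  ∀ x y, ξ y ≥ ξ x + inner ℝ (gradient ξ x) (y - x) + α / 2 * ‖y - x‖ ^ 2

/-- The average `f = (1/n) ∑ i, f i` of the local objective functions. -/
def objective (f : Fin n → EuclideanSpace ℝ (Fin N) → ℝ) (y : EuclideanSpace ℝ (Fin N)) : ℝ :=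
  (1 / (n : ℝ)) * ∑ i, f i y

/-- The average of the `n` rows of a stacked vector. -/
def avg (v : Fin n → EuclideanSpace ℝ (Fin N)) : EuclideanSpace ℝ (Fin N) :=
  (1 / (n : ℝ)) • ∑ i, v i

/-- The Frobenius norm of the `n × N` matrix with rows `v i`. -/
def frob (v : Fin n → EuclideanSpace ℝ (Fin N)) : ℝ :=
  Real.sqrt (∑ i, ‖v i‖ ^ 2)

/-- The lazy Metropolis weight matrix of a graph on the agents. -/
def lazyMetropolis (𝒢 : SimpleGraph (Fin n)) [DecidableRel 𝒢.Adj] :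
    Matrix (Fin n) (Fin n) ℝ :=
  Matrix.of fun i j =>
    if i = j then
      1 - ∑ q ∈ 𝒢.neighborFinset i, 1 / (2 * max (𝒢.degree i : ℝ) (𝒢.degree q : ℝ))
    else if 𝒢.Adj i j then 1 / (2 * max (𝒢.degree i : ℝ) (𝒢.degree j : ℝ))
    else 0

/-- `σ`: the spectral norm (operator norm for the Euclidean norm) of `W - (1/n) 𝟏 𝟏ᵀ`. -/
def sigma (W : Matrix (Fin n) (Fin n) ℝ) : ℝ :=
  ‖Matrix.toEuclideanCLM (n := Fin n) (𝕜 := ℝ) (W - Matrix.of fun _ _ => 1 / (n : ℝ))‖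

/-- The `3 × 3` matrix `G(η)`, with `λ = max (|1 - αη|) (|1 - βη|)`. -/
def Gmat (σ α β η : ℝ) : Matrix (Fin 3) (Fin 3) ℝ :=
  !![σ + β * η, β * (η * β + 2), η * β ^ 2;
     η, σ, 0;
     0, η * β, max |1 - α * η| |1 - β * η|]

/-- The spectral radius of a real square matrix: the largest modulus of a complex eigenvalue. -/
def rho {m : ℕ} (A : Matrix (Fin m) (Fin m) ℝ) : ℝ :=
  (spectralRadius ℂ (A.map (fun r : ℝ => (r : ℂ)))).toReal

/-- The pair `(x(t), s(t))` of stacked iterates of the algorithm with weights `W`, local functions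
`f`, step size `η` and initial point `x0`. -/
def iter (W : Matrix (Fin n) (Fin n) ℝ) (f : Fin n → EuclideanSpace ℝ (Fin N) → ℝ) (η : ℝ)
    (x0 : Fin n → EuclideanSpace ℝ (Fin N)) :
    ℕ → (Fin n → EuclideanSpace ℝ (Fin N)) × (Fin n → EuclideanSpace ℝ (Fin N))
  | 0 => (x0, fun i => gradient (f i) (x0 i))
  | t + 1 =>
    let p := iter W f η x0 t
    let x' : Fin n → EuclideanSpace ℝ (Fin N) := fun i => (∑ j, W i j • p.1 j) - η • p.2 i
    (x', fun i => (∑ j, W i j • p.2 j) + gradient (f i) (x' i) - gradient (f i) (p.1 i))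

/-- The estimate `x_i(t)` of agent `i`. -/
def xIter (W : Matrix (Fin n) (Fin n) ℝ) (f : Fin n → EuclideanSpace ℝ (Fin N) → ℝ) (η : ℝ)
    (x0 : Fin n → EuclideanSpace ℝ (Fin N)) (t : ℕ) (i : Fin n) : EuclideanSpace ℝ (Fin N) :=
  (iter W f η x0 t).1 i

/-- The gradient estimate `s_i(t)` of agent `i`. -/
def sIter (W : Matrix (Fin n) (Fin n) ℝ) (f : Fin n → EuclideanSpace ℝ (Fin N) → ℝ) (η : ℝ)
    (x0 : Fin n → EuclideanSpace ℝ (Fin N)) (t : ℕ) (i : Fin n) : EuclideanSpace ℝ (Fin N) :=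
  (iter W f η x0 t).2 i

/-- The average estimate `x̄(t)`. -/
def xBar (W : Matrix (Fin n) (Fin n) ℝ) (f : Fin n → EuclideanSpace ℝ (Fin N) → ℝ) (η : ℝ)
    (x0 : Fin n → EuclideanSpace ℝ (Fin N)) (t : ℕ) : EuclideanSpace ℝ (Fin N) :=
  avg (xIter W f η x0 t)

/-- The average gradient `g(t) = (1/n) ∑ i, ∇ f_i (x_i(t))`. -/
def gAvg (W : Matrix (Fin n) (Fin n) ℝ) (f : Fin n → EuclideanSpace ℝ (Fin N) → ℝ) (η : ℝ)
    (x0 : Fin n → EuclideanSpace ℝ (Fin N)) (t : ℕ) : EuclideanSpace ℝ (Fin N) :=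
  avg fun i => gradient (f i) (xIter W f η x0 t i)

/-- The running average `x̂_i(t+1) = (1/(t+1)) ∑_{k=0}^{t} x_i(k+1)`, as a function of `t`. -/
def xHatSucc (W : Matrix (Fin n) (Fin n) ℝ) (f : Fin n → EuclideanSpace ℝ (Fin N) → ℝ) (η : ℝ)
    (x0 : Fin n → EuclideanSpace ℝ (Fin N)) (t : ℕ) (i : Fin n) : EuclideanSpace ℝ (Fin N) :=
  (1 / ((t : ℝ) + 1)) • ∑ k ∈ Finset.range (t + 1), xIter W f η x0 (k + 1) i

/-- `‖x(t) - 𝟏 x̄(t)‖`, Frobenius norm. -/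
def consErr (W : Matrix (Fin n) (Fin n) ℝ) (f : Fin n → EuclideanSpace ℝ (Fin N) → ℝ) (η : ℝ)
    (x0 : Fin n → EuclideanSpace ℝ (Fin N)) (t : ℕ) : ℝ :=
  frob fun i => xIter W f η x0 t i - xBar W f η x0 t

/-- `‖s(t) - 𝟏 g(t)‖`, Frobenius norm. -/
def gradErr (W : Matrix (Fin n) (Fin n) ℝ) (f : Fin n → EuclideanSpace ℝ (Fin N) → ℝ) (η : ℝ)
    (x0 : Fin n → EuclideanSpace ℝ (Fin N)) (t : ℕ) : ℝ :=
  frob fun i => sIter W f η x0 t i - gAvg W f η x0 t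

end DistOpt

end

/-!
Gradient tracking with lazy Metropolis weights converges because three errors control each other:
the tracking error `S = ‖s - 𝟏 g‖`, the consensus error `δ = ‖x - 𝟏 x̄‖`, and the distance of the
average `x̄` to the minimizer. The average of the `s_i` is always the average `g` of the local
gradients (`avg_sIter`), so `x̄` performs a gradient step on the objective with an inexact gradient.

The spectral gap `1 - σ` is bounded below through effective resistances. An edge `ij` has
resistance `2 max (d_i, d_j)`, and the degrees along a shortest path add up to at most `3 n`, because
a vertex is adjacent to at most three vertices of a shortest path. Hence any two agents have
resistance at most `12 n` (`sub_sq_le_dirichlet`), which gives a Poincaré inequality. Laziness makes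
`W` positive semidefinite, so the quadratic form of `W - 𝟏𝟏ᵀ/n` determines `σ`, and the gap is at
least `1 / (12 n²)` (`sigma_lazyMetropolis_le`), better than the `1 / (71 U²)` that the step sizes
presuppose.

In the strongly convex case the error vector satisfies `z (t + 1) ≤ G(η) z t` entrywise
(`errVec_succ_le`); its last row uses the contraction of the exact gradient step, which follows
from cocoercivity. The intermediate value theorem applied to the characteristic equation gives an
eigenvalue of `G(η)` between `1 - αη` and `1 - αη / 2` with an explicit positive eigenvector
(`exists_pos_eigenvector_Gmat`). A positive eigenvector of a nonnegative matrix belongs to its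
spectral radius, and comparison with it bounds `z t` by a multiple of `ρ ^ t` with no loss in the
rate. The bound on `f (x_i) - f*` is then the quadratic upper bound at the minimizer.

In the convex case, `δ² + (1 - σ)² (S / β)² / 24` is a Lyapunov function: summing its decrease
bounds `∑ δ²` by the initial errors plus a quarter of `η² n ∑ ‖g‖²` (`sum_consErr_sq_le`). Summing the
inexact gradient inequality bounds `∑ (f (x̄) - f*)` with a negative multiple of `∑ ‖g‖²` and a
positive multiple of `∑ δ²` (`sum_objective_xBar_sub_le`). As `βη` is small the negative term
absorbs the gradients, and Jensen's inequality passes to the running averages.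
-/

noncomputable section

namespace DistOpt

/-! ### Smooth and strongly convex functions -/

section Convex

variable {E : Type*} [NormedAddCommGroup E] [InnerProductSpace ℝ E]

theorem hasDerivAt_comp_line [CompleteSpace E] {φ : E → ℝ} (hφ : Differentiable ℝ φ)
    (x d : E) (t : ℝ) :
    HasDerivAt (fun s : ℝ => φ (x + s • d)) (inner ℝ (gradient φ (x + t • d)) d) t := by
  have h1 : HasDerivAt (fun s : ℝ => x + s • d) d t := by
    simpa using ((hasDerivAt_id t).smul_const d).const_add x
  rw [inner_gradient_left]
  exact (hφ (x + t • d)).hasFDerivAt.comp_hasDerivAt t h1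

/-- First-order characterisation of convexity: the graph lies above its tangent planes. -/
theorem add_inner_gradient_le_of_convexOn [CompleteSpace E] {φ : E → ℝ} (hc : ConvexOn ℝ univ φ)
    (hφ : Differentiable ℝ φ) (x y : E) :
    φ x + inner ℝ (gradient φ x) (y - x) ≤ φ y := by
  have hline : ConvexOn ℝ univ (fun s : ℝ => φ (x + s • (y - x))) := by
    have := hc.comp_affineMap (AffineMap.lineMap x y : ℝ →ᵃ[ℝ] E)
    rw [preimage_univ] at this
    have e : (fun s : ℝ => φ (x + s • (y - x))) = φ ∘ (AffineMap.lineMap x y : ℝ →ᵃ[ℝ] E) := by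
      ext s
      simp [AffineMap.lineMap_apply, add_comm]
    rw [e]
    exact this
  have hd := hasDerivAt_comp_line hφ x (y - x) 0
  have h := hline.le_slope_of_hasDerivAt (mem_univ 0) (mem_univ 1) one_pos hd
  simp only [slope_def_field, zero_smul, add_zero, one_smul, add_sub_cancel, sub_zero,
    div_one] at h
  linarith

/-- The quadratic upper bound satisfied by a function with a `β`-Lipschitz gradient. -/
theorem le_add_inner_gradient_add_sq [CompleteSpace E] {φ : E → ℝ} {β : ℝ} (hφ : Differentiable ℝ φ)
    (hL : ∀ x y, ‖gradient φ x - gradient φ y‖ ≤ β * ‖x - y‖) (x y : E) :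
    φ y ≤ φ x + inner ℝ (gradient φ x) (y - x) + β / 2 * ‖y - x‖ ^ 2 := by
  set d := y - x with hd
  let h : ℝ → ℝ := fun s =>
    φ (x + s • d) - (s * inner ℝ (gradient φ x) d + β / 2 * ‖d‖ ^ 2 * s ^ 2)
  have hder : ∀ s : ℝ, HasDerivAt h (inner ℝ (gradient φ (x + s • d)) d
      - (inner ℝ (gradient φ x) d + β / 2 * ‖d‖ ^ 2 * (2 * s))) s := by
    intro s
    refine (hasDerivAt_comp_line hφ x d s).sub (HasDerivAt.add ?_ ?_)
    · simpa using (hasDerivAt_id s).mul_const (inner ℝ (gradient φ x) d)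
    · simpa using (hasDerivAt_pow 2 s).const_mul (β / 2 * ‖d‖ ^ 2)
  have hanti : AntitoneOn h (Icc 0 1) := by
    refine antitoneOn_of_deriv_nonpos (convex_Icc 0 1)
      (fun s _ => (hder s).continuousAt.continuousWithinAt)
      (fun s _ => (hder s).differentiableAt.differentiableWithinAt) ?_
    intro s hs
    rw [interior_Icc] at hs
    rw [(hder s).deriv]
    have h1 : inner ℝ (gradient φ (x + s • d) - gradient φ x) d
        ≤ ‖gradient φ (x + s • d) - gradient φ x‖ * ‖d‖ := real_inner_le_norm _ _
    have h2 := hL (x + s • d) x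
    rw [add_sub_cancel_left, norm_smul, Real.norm_of_nonneg hs.1.le] at h2
    have h3 := mul_le_mul_of_nonneg_right h2 (norm_nonneg d)
    rw [inner_sub_left] at h1
    nlinarith
  have := hanti (left_mem_Icc.2 zero_le_one) (right_mem_Icc.2 zero_le_one) zero_le_one
  simp only [h, one_smul, zero_smul, add_zero, hd, add_sub_cancel] at this
  rw [← hd] at this
  linarith

/-- Cocoercivity of a gradient-like map `G`, from a tangent lower bound and a quadratic upper
bound. -/
theorem norm_sub_sq_le_mul_inner {φ : E → ℝ} {G : E → E} {L : ℝ} (hL : 0 ≤ L)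
    (hlow : ∀ x y, φ x + inner ℝ (G x) (y - x) ≤ φ y)
    (hup : ∀ x y, φ y ≤ φ x + inner ℝ (G x) (y - x) + L / 2 * ‖y - x‖ ^ 2) (x y : E) :
    ‖G x - G y‖ ^ 2 ≤ L * inner ℝ (G x - G y) (x - y) := by
  -- Compare the two bounds at the point reached from `y` by a step `s` along `G x - G y`.
  have key : ∀ (s : ℝ) (x y : E), φ x + inner ℝ (G x) (y - x)
      + (s - L / 2 * s ^ 2) * ‖G x - G y‖ ^ 2 ≤ φ y := by
    intro s x y
    have h1 := hlow x (y + s • (G x - G y))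
    have h2 := hup y (y + s • (G x - G y))
    have e1 : y + s • (G x - G y) - x = (y - x) + s • (G x - G y) := by abel
    rw [e1, inner_add_right, inner_smul_right] at h1
    rw [add_sub_cancel_left, inner_smul_right, norm_smul, mul_pow, Real.norm_eq_abs, sq_abs] at h2
    have e2 : ‖G x - G y‖ ^ 2 = inner ℝ (G x) (G x - G y) - inner ℝ (G y) (G x - G y) := by
      rw [← inner_sub_left, real_inner_self_eq_norm_sq]
    linear_combination h1 + h2 + s * e2
  have hsum : ∀ s : ℝ, (2 * s - L * s ^ 2) * ‖G x - G y‖ ^ 2 ≤ inner ℝ (G x - G y) (x - y) := by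
    intro s
    have h1 := key s x y
    have h2 := key s y x
    rw [norm_sub_rev (G y)] at h2
    have e : inner ℝ (G x - G y) (x - y)
        = - inner ℝ (G x) (y - x) - inner ℝ (G y) (x - y) := by
      rw [← neg_sub x y, inner_neg_right, inner_sub_left]; ring
    rw [e]; linarith
  rcases hL.eq_or_lt with rfl | hLpos
  · -- For `L = 0` every step length is admissible, which forces `G x = G y`.
    by_contra hcon
    have hpos : 0 < ‖G x - G y‖ ^ 2 := by rw [zero_mul] at hcon; exact not_le.1 hcon
    have hne := hpos.ne'
    have h := hsum ((inner ℝ (G x - G y) (x - y) + 1) / (2 * ‖G x - G y‖ ^ 2))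
    generalize ‖G x - G y‖ ^ 2 = Q at h hne
    generalize inner ℝ (G x - G y) (x - y) = A at h
    have e : (2 * ((A + 1) / (2 * Q)) - 0 * ((A + 1) / (2 * Q)) ^ 2) * Q = A + 1 := by
      field_simp
      ring
    linarith
  · have h := hsum (1 / L)
    have e : (2 * (1 / L) - L * (1 / L) ^ 2) = 1 / L := by field_simp; ring
    rw [e, one_div, inv_mul_le_iff₀ hLpos] at h
    exact h

/-- Coercivity of the gradient of a strongly convex smooth function. -/
theorem norm_sq_add_le_inner_of_strong {φ : E → ℝ} {G : E → E} {α β : ℝ} (hαβ : α ≤ β)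
    (hlow : ∀ x y, φ x + inner ℝ (G x) (y - x) + α / 2 * ‖y - x‖ ^ 2 ≤ φ y)
    (hup : ∀ x y, φ y ≤ φ x + inner ℝ (G x) (y - x) + β / 2 * ‖y - x‖ ^ 2) (x y : E) :
    ‖G x - G y‖ ^ 2 + α * β * ‖x - y‖ ^ 2 ≤ (α + β) * inner ℝ (G x - G y) (x - y) := by
  -- Subtracting `α/2 ‖·‖²` leaves a convex function with quadratic upper constant `β - α`.
  have hq : ∀ x y : E, ‖y‖ ^ 2 = ‖x‖ ^ 2 + 2 * inner ℝ x (y - x) + ‖y - x‖ ^ 2 := by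
    intro x y
    rw [← norm_add_sq_real, add_sub_cancel]
  have h := norm_sub_sq_le_mul_inner (φ := fun z => φ z - α / 2 * ‖z‖ ^ 2)
    (G := fun z => G z - α • z) (L := β - α) (by linarith)
    (fun x y => by
      have h1 := hlow x y
      have h2 := hq x y
      simp only [inner_sub_left, inner_smul_left, RCLike.conj_to_real]
      rw [h2]; linarith)
    (fun x y => by
      have h1 := hup x y
      have h2 := hq x y
      simp only [inner_sub_left, inner_smul_left, RCLike.conj_to_real]
      rw [h2]; linarith) x y
  have e : G x - α • x - (G y - α • y) = (G x - G y) - α • (x - y) := by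
    rw [smul_sub]; abel
  simp only [e] at h
  rw [norm_sub_sq_real, inner_smul_right, norm_smul, mul_pow, Real.norm_eq_abs, sq_abs,
    inner_sub_left (G x - G y), inner_smul_left, RCLike.conj_to_real,
    real_inner_self_eq_norm_sq] at h
  linarith

/-- One gradient step contracts the distance between two points by `1 - αη`, as long as
`η ≤ 2 / (α + β)`. -/
theorem norm_gradient_step_le {φ : E → ℝ} {G : E → E} {α β η : ℝ} (hαβ : α ≤ β)
    (hη : 0 < η) (hη2 : η * (α + β) ≤ 2)
    (hlow : ∀ x y, φ x + inner ℝ (G x) (y - x) + α / 2 * ‖y - x‖ ^ 2 ≤ φ y)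
    (hup : ∀ x y, φ y ≤ φ x + inner ℝ (G x) (y - x) + β / 2 * ‖y - x‖ ^ 2) (x y : E) :
    ‖x - y - η • (G x - G y)‖ ≤ |1 - α * η| * ‖x - y‖ := by
  have hco := norm_sq_add_le_inner_of_strong hαβ hlow hup x y
  have hst : α * ‖x - y‖ ^ 2 ≤ inner ℝ (G x - G y) (x - y) := by
    have h1 := hlow x y
    have h2 := hlow y x
    rw [norm_sub_rev y x] at h1
    have e : inner ℝ (G x - G y) (x - y)
        = - inner ℝ (G x) (y - x) - inner ℝ (G y) (x - y) := by
      rw [← neg_sub x y, inner_neg_right, inner_sub_left]; ring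
    rw [e]; linarith
  refine abs_le_of_sq_le_sq' ?_ (by positivity) |>.2
  rw [norm_sub_sq_real, inner_smul_right, norm_smul, mul_pow, mul_pow, sq_abs, Real.norm_eq_abs,
    sq_abs, real_inner_comm]
  set A := inner ℝ (G x - G y) (x - y)
  set D := ‖x - y‖ ^ 2
  set Q := ‖G x - G y‖ ^ 2
  have h1 : η ^ 2 * (Q + α * β * D) ≤ η ^ 2 * ((α + β) * A) :=
    mul_le_mul_of_nonneg_left hco (sq_nonneg _)
  have h2 : 0 ≤ (η * (2 - η * (α + β))) * (A - α * D) :=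
    mul_nonneg (mul_nonneg hη.le (by linarith)) (by linarith)
  nlinarith

end Convex

/-! ### The spectral gap of the lazy Metropolis matrix -/

section Graph

variable {V : Type*} {𝒢 : SimpleGraph V}

theorem dist_getVert_of_length_eq_dist (h𝒢 : 𝒢.Connected) {u v : V} (p : 𝒢.Walk u v)
    (hp : p.length = 𝒢.dist u v) {k : ℕ} (hk : k ≤ p.length) :
    𝒢.dist u (p.getVert k) = k := by
  have h1 := 𝒢.dist_le (p.take k)
  have h2 := 𝒢.dist_le (p.drop k)
  have h3 := h𝒢.dist_triangle (u := u) (v := p.getVert k) (w := v)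
  rw [SimpleGraph.Walk.take_length] at h1
  rw [SimpleGraph.Walk.drop_length] at h2
  omega

/-- The degrees along a shortest path add up to at most three times the number of vertices: every
vertex is adjacent to at most three vertices of a shortest path. -/
theorem sum_degree_le_of_length_eq_dist [Fintype V] [DecidableRel 𝒢.Adj] (h𝒢 : 𝒢.Connected)
    {u v : V} (p : 𝒢.Walk u v) (hp : p.length = 𝒢.dist u v) :
    ∑ k ∈ Finset.range (p.length + 1), 𝒢.degree (p.getVert k) ≤ 3 * Fintype.card V := by
  classical
  have h1 : ∀ k, 𝒢.degree (p.getVert k) = ∑ w : V, if 𝒢.Adj (p.getVert k) w then 1 else 0 := by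
    intro k
    rw [← SimpleGraph.card_neighborFinset_eq_degree, SimpleGraph.neighborFinset_eq_filter,
      Finset.card_filter]
  simp_rw [h1]
  rw [Finset.sum_comm]
  have h2 : ∀ w : V, (∑ k ∈ Finset.range (p.length + 1),
      if 𝒢.Adj (p.getVert k) w then 1 else 0) ≤ 3 := by
    intro w
    rw [← Finset.card_filter]
    -- The distance from `u` changes by at most one along an edge.
    have hsub : (Finset.range (p.length + 1)).filter (fun k => 𝒢.Adj (p.getVert k) w)
        ⊆ Finset.Icc (𝒢.dist u w - 1) (𝒢.dist u w + 1) := by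
      intro k hk
      simp only [Finset.mem_filter, Finset.mem_range] at hk
      have hd := dist_getVert_of_length_eq_dist h𝒢 p hp (k := k) (by omega)
      have := hk.2.diff_dist_adj (u := u)
      rw [Finset.mem_Icc]
      omega
    refine (Finset.card_le_card hsub).trans ?_
    rw [Nat.card_Icc]
    omega
  calc _ ≤ ∑ _w : V, 3 := Finset.sum_le_sum fun w _ => h2 w
    _ = _ := by simp [mul_comm]

end Graph

section LazyMetropolis

variable {n : ℕ} (𝒢 : SimpleGraph (Fin n)) [DecidableRel 𝒢.Adj]

theorem lazyMetropolis_isSymm (i j : Fin n) :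
    lazyMetropolis 𝒢 i j = lazyMetropolis 𝒢 j i := by
  by_cases h : i = j
  · rw [h]
  · simp only [lazyMetropolis, Matrix.of_apply, 𝒢.adj_comm j i, max_comm (𝒢.degree j : ℝ),
      if_neg h, if_neg (Ne.symm h)]

theorem lazyMetropolis_of_adj {i j : Fin n} (h : 𝒢.Adj i j) :
    lazyMetropolis 𝒢 i j = 1 / (2 * max (𝒢.degree i : ℝ) (𝒢.degree j : ℝ)) := by
  simp [lazyMetropolis, h.ne, h]

theorem lazyMetropolis_sum_row (i : Fin n) : ∑ j, lazyMetropolis 𝒢 i j = 1 := by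
  rw [← Finset.add_sum_erase _ _ (Finset.mem_univ i)]
  have h : ∑ j ∈ Finset.univ.erase i, lazyMetropolis 𝒢 i j
      = ∑ q ∈ 𝒢.neighborFinset i, 1 / (2 * max (𝒢.degree i : ℝ) (𝒢.degree q : ℝ)) := by
    symm
    refine Finset.sum_subset_zero_on_sdiff ?_ ?_ ?_
    · intro q hq
      rw [SimpleGraph.mem_neighborFinset] at hq
      simpa using hq.ne'
    · intro q hq
      simp only [Finset.mem_sdiff, Finset.mem_erase, Finset.mem_univ, and_true,
        SimpleGraph.mem_neighborFinset] at hq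
      simp [lazyMetropolis, hq.2, Ne.symm hq.1]
    · intro q hq
      rw [SimpleGraph.mem_neighborFinset] at hq
      rw [lazyMetropolis_of_adj 𝒢 hq]
  rw [h]
  simp [lazyMetropolis]

theorem lazyMetropolis_nonneg_of_ne {i j : Fin n} (h : i ≠ j) : 0 ≤ lazyMetropolis 𝒢 i j := by
  simp only [lazyMetropolis, Matrix.of_apply, if_neg h]
  split_ifs <;> positivity

/-- Laziness: every agent keeps at least half of its own weight. -/
theorem half_le_lazyMetropolis_self (i : Fin n) : 1 / 2 ≤ lazyMetropolis 𝒢 i i := by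
  simp only [lazyMetropolis, Matrix.of_apply, if_true]
  have h : ∑ q ∈ 𝒢.neighborFinset i, 1 / (2 * max (𝒢.degree i : ℝ) (𝒢.degree q : ℝ))
      ≤ ∑ q ∈ 𝒢.neighborFinset i, 1 / (2 * (𝒢.degree i : ℝ)) := by
    refine Finset.sum_le_sum fun q hq => ?_
    have hpos : 0 < 𝒢.degree i := by
      rw [← 𝒢.card_neighborFinset_eq_degree]
      exact Finset.card_pos.2 ⟨q, hq⟩
    have : (0 : ℝ) < 𝒢.degree i := by exact_mod_cast hpos
    gcongr
    exact le_max_left _ _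
  rw [Finset.sum_const, SimpleGraph.card_neighborFinset_eq_degree, nsmul_eq_mul] at h
  rcases Nat.eq_zero_or_pos (𝒢.degree i) with h0 | h0
  · rw [h0, Nat.cast_zero, zero_mul] at h
    rw [h0, Nat.cast_zero]
    linarith
  · have : (0 : ℝ) < 𝒢.degree i := by exact_mod_cast h0
    have e : (𝒢.degree i : ℝ) * (1 / (2 * (𝒢.degree i : ℝ))) = 1 / 2 := by field_simp
    linarith

/-- The Dirichlet form of a weight matrix, every edge being counted in both directions. -/
def dirichlet (W : Matrix (Fin n) (Fin n) ℝ) (v : Fin n → ℝ) : ℝ :=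
  ∑ i, ∑ j, W i j * (v i - v j) ^ 2

theorem dirichlet_eq {W : Matrix (Fin n) (Fin n) ℝ} (hsymm : ∀ i j, W i j = W j i)
    (hrow : ∀ i, ∑ j, W i j = 1) (v : Fin n → ℝ) :
    dirichlet W v = 2 * ∑ i, v i ^ 2 - 2 * ∑ i, ∑ j, W i j * (v i * v j) := by
  have h1 : ∑ i, ∑ j, W i j * v i ^ 2 = ∑ i, v i ^ 2 := by
    refine Finset.sum_congr rfl fun i _ => ?_
    rw [← Finset.sum_mul, hrow, one_mul]
  have h2 : ∑ i, ∑ j, W i j * v j ^ 2 = ∑ i, v i ^ 2 := by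
    rw [Finset.sum_comm, ← h1]
    exact Finset.sum_congr rfl fun i _ => Finset.sum_congr rfl fun j _ => by rw [hsymm]
  have h3 : dirichlet W v = ∑ i, ∑ j, W i j * v i ^ 2 + ∑ i, ∑ j, W i j * v j ^ 2
      - 2 * ∑ i, ∑ j, W i j * (v i * v j) := by
    simp only [dirichlet, Finset.mul_sum, ← Finset.sum_add_distrib, ← Finset.sum_sub_distrib]
    exact Finset.sum_congr rfl fun i _ => Finset.sum_congr rfl fun j _ => by ring
  rw [h3, h1, h2]; ring

/-- The Dirichlet form of a lazy matrix is at most twice the squared norm. -/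
theorem dirichlet_lazyMetropolis_le (v : Fin n → ℝ) :
    dirichlet (lazyMetropolis 𝒢) v ≤ 2 * ∑ i, v i ^ 2 := by
  classical
  have h1 : ∑ i, ∑ j, lazyMetropolis 𝒢 i j * (2 * v i ^ 2) = 2 * ∑ i, v i ^ 2 := by
    rw [Finset.mul_sum]
    refine Finset.sum_congr rfl fun i _ => ?_
    rw [← Finset.sum_mul, lazyMetropolis_sum_row, one_mul]
  have h2 : ∑ i, ∑ j, lazyMetropolis 𝒢 i j * (2 * v j ^ 2) = 2 * ∑ i, v i ^ 2 := by
    rw [Finset.sum_comm, ← h1]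
    exact Finset.sum_congr rfl fun i _ => Finset.sum_congr rfl fun j _ => by
      rw [lazyMetropolis_isSymm]
  have h3 : dirichlet (lazyMetropolis 𝒢) v ≤ ∑ i, ∑ j, lazyMetropolis 𝒢 i j * (2 * v i ^ 2)
      + ∑ i, ∑ j, lazyMetropolis 𝒢 i j * (2 * v j ^ 2) - ∑ i, 2 * v i ^ 2 := by
    rw [dirichlet, ← Finset.sum_add_distrib, ← Finset.sum_sub_distrib]
    refine Finset.sum_le_sum fun i _ => ?_
    rw [← Finset.sum_add_distrib,
      show 2 * v i ^ 2 = ∑ j, if j = i then 2 * v i ^ 2 else 0 by simp,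
      ← Finset.sum_sub_distrib]
    refine Finset.sum_le_sum fun j _ => ?_
    by_cases hij : j = i
    · subst hij
      have := half_le_lazyMetropolis_self 𝒢 j
      simp only [sub_self, Finset.sum_ite_eq', Finset.mem_univ, if_true]
      nlinarith [sq_nonneg (v j)]
    · have := lazyMetropolis_nonneg_of_ne 𝒢 (Ne.symm hij)
      simp only [if_neg hij, Finset.sum_ite_eq', Finset.mem_univ, if_true]
      nlinarith [mul_nonneg this (sq_nonneg (v i + v j))]
  rw [h1, h2, ← Finset.mul_sum] at h3
  linarith

/-- Effective resistance bound: along a shortest path from `a` to `b` the edge resistances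
`2 max (d_i, d_j)` add up to at most `12 n`. -/
theorem sub_sq_le_dirichlet {𝒢 : SimpleGraph (Fin n)} [DecidableRel 𝒢.Adj] (h𝒢 : 𝒢.Connected)
    (v : Fin n → ℝ) (a b : Fin n) :
    (v a - v b) ^ 2 ≤ 12 * n * dirichlet (lazyMetropolis 𝒢) v := by
  obtain ⟨p, hp⟩ := h𝒢.exists_walk_length_eq_dist a b
  set L := p.length
  let q : ℕ → Fin n := p.getVert
  have hadj : ∀ k ∈ Finset.range L, 𝒢.Adj (q k) (q (k + 1)) := fun k hk =>
    p.adj_getVert_succ (Finset.mem_range.1 hk)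
  let w : ℕ → ℝ := fun k => lazyMetropolis 𝒢 (q k) (q (k + 1))
  have hmax : ∀ k ∈ Finset.range L,
      0 < max (𝒢.degree (q k) : ℝ) (𝒢.degree (q (k + 1)) : ℝ) := by
    intro k hk
    have : 0 < 𝒢.degree (q k) := (𝒢.degree_pos_iff_exists_adj _).2 ⟨_, hadj k hk⟩
    exact lt_max_of_lt_left (by exact_mod_cast this)
  have hw : ∀ k ∈ Finset.range L, 0 < w k := by
    intro k hk
    have := hmax k hk
    simp only [w, lazyMetropolis_of_adj 𝒢 (hadj k hk)]
    positivity
  have hres : ∑ k ∈ Finset.range L, 1 / w k ≤ 12 * n := by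
    have h1 : ∑ k ∈ Finset.range L, 1 / w k ≤ ∑ k ∈ Finset.range L,
        (2 * (𝒢.degree (q k) : ℝ) + 2 * (𝒢.degree (q (k + 1)) : ℝ)) := by
      refine Finset.sum_le_sum fun k hk => ?_
      simp only [w, lazyMetropolis_of_adj 𝒢 (hadj k hk), one_div_one_div]
      have := max_le_add_of_nonneg (Nat.cast_nonneg (α := ℝ) (𝒢.degree (q k)))
        (Nat.cast_nonneg (α := ℝ) (𝒢.degree (q (k + 1))))
      linarith
    have hsum := sum_degree_le_of_length_eq_dist h𝒢 p hp
    rw [Fintype.card_fin] at hsum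
    have hsumR : ∑ k ∈ Finset.range (L + 1), (𝒢.degree (q k) : ℝ) ≤ 3 * n := by
      exact_mod_cast hsum
    have h2 : ∑ k ∈ Finset.range L, (𝒢.degree (q k) : ℝ) ≤ 3 * n := by
      rw [Finset.sum_range_succ] at hsumR
      have : (0 : ℝ) ≤ 𝒢.degree (q L) := Nat.cast_nonneg _
      linarith
    have h3 : ∑ k ∈ Finset.range L, (𝒢.degree (q (k + 1)) : ℝ) ≤ 3 * n := by
      rw [Finset.sum_range_succ'] at hsumR
      have : (0 : ℝ) ≤ 𝒢.degree (q 0) := Nat.cast_nonneg _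
      linarith
    rw [Finset.sum_add_distrib, ← Finset.mul_sum, ← Finset.mul_sum] at h1
    linarith
  have hen : ∑ k ∈ Finset.range L, w k * (v (q k) - v (q (k + 1))) ^ 2
      ≤ dirichlet (lazyMetropolis 𝒢) v := by
    let F : Fin n × Fin n → ℝ := fun e => lazyMetropolis 𝒢 e.1 e.2 * (v e.1 - v e.2) ^ 2
    have hinj : Set.InjOn (fun k => (q k, q (k + 1))) (Finset.range L) := by
      intro k hk l hl hkl
      have hk' := dist_getVert_of_length_eq_dist h𝒢 p hp (Finset.mem_range.1 hk).le
      have hl' := dist_getVert_of_length_eq_dist h𝒢 p hp (Finset.mem_range.1 hl).le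
      have : q k = q l := (Prod.ext_iff.1 hkl).1
      rw [← hk', ← hl']
      exact congrArg _ this
    have : ∑ k ∈ Finset.range L, w k * (v (q k) - v (q (k + 1))) ^ 2
        = ∑ e ∈ (Finset.range L).image (fun k => (q k, q (k + 1))), F e := by
      rw [Finset.sum_image hinj]
    rw [this]
    calc _ ≤ ∑ e, F e := by
          refine Finset.sum_le_sum_of_subset_of_nonneg (Finset.subset_univ _) fun e _ _ => ?_
          by_cases he : e.1 = e.2
          · simp [F, he]
          · exact mul_nonneg (lazyMetropolis_nonneg_of_ne 𝒢 he) (sq_nonneg _)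
      _ = _ := Fintype.sum_prod_type _
  have htel : v a - v b = ∑ k ∈ Finset.range L, (v (q k) - v (q (k + 1))) := by
    rw [Finset.sum_range_sub' (fun k => v (q k))]
    simp [q, L]
  have hcs := Finset.sum_sq_le_sum_mul_sum_of_sq_le_mul (Finset.range L)
    (r := fun k => v (q k) - v (q (k + 1))) (f := fun k => 1 / w k)
    (g := fun k => w k * (v (q k) - v (q (k + 1))) ^ 2)
    (fun k hk => by have := hw k hk; positivity)
    (fun k hk => by have := hw k hk; positivity)
    (fun k hk => le_of_eq (by have := (hw k hk).ne'; field_simp))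
  rw [htel]
  refine hcs.trans (mul_le_mul hres hen ?_ (by positivity))
  exact Finset.sum_nonneg fun k hk => by have := hw k hk; positivity

/-- Poincaré inequality for the lazy Metropolis weights. -/
theorem sum_sq_le_dirichlet {𝒢 : SimpleGraph (Fin n)} [DecidableRel 𝒢.Adj] (h𝒢 : 𝒢.Connected)
    {v : Fin n → ℝ} (hv : ∑ i, v i = 0) :
    ∑ i, v i ^ 2 ≤ 6 * n ^ 2 * dirichlet (lazyMetropolis 𝒢) v := by
  have := h𝒢.nonempty
  have hn : (0 : ℝ) < n := by exact_mod_cast Fin.pos_iff_nonempty.2 this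
  have h1 : ∑ i, ∑ j, (v i - v j) ^ 2 = 2 * n * ∑ i, v i ^ 2 := by
    have : ∀ i, ∑ j, (v i - v j) ^ 2 = n * v i ^ 2 + ∑ j, v j ^ 2 := by
      intro i
      simp only [sub_sq, Finset.sum_add_distrib, Finset.sum_sub_distrib, ← Finset.mul_sum, hv]
      simp
    simp only [this, Finset.sum_add_distrib, ← Finset.mul_sum]
    simp only [Finset.sum_const, Finset.card_univ, Fintype.card_fin, nsmul_eq_mul]
    ring
  have h2 : ∑ i, ∑ j, (v i - v j) ^ 2
      ≤ ∑ _i : Fin n, ∑ _j : Fin n, 12 * n * dirichlet (lazyMetropolis 𝒢) v :=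
    Finset.sum_le_sum fun i _ => Finset.sum_le_sum fun j _ => sub_sq_le_dirichlet h𝒢 v i j
  rw [h1] at h2
  simp only [Finset.sum_const, Finset.card_univ, Fintype.card_fin, nsmul_eq_mul] at h2
  have h3 : 2 * n * ∑ i, v i ^ 2 ≤ 2 * n * (6 * n ^ 2 * dirichlet (lazyMetropolis 𝒢) v) := by
    linarith
  exact le_of_mul_le_mul_left h3 (by positivity)

/-- A symmetric operator is bounded by its quadratic form. -/
theorem opNorm_le_of_abs_inner_self_le {H : Type*} [NormedAddCommGroup H] [InnerProductSpace ℝ H]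
    (A : H →L[ℝ] H) (hA : ∀ x y, inner ℝ x (A y) = inner ℝ y (A x)) {c : ℝ} (hc : 0 ≤ c)
    (hform : ∀ x, |inner ℝ x (A x)| ≤ c * ‖x‖ ^ 2) : ‖A‖ ≤ c := by
  -- Polarisation bounds the bilinear form by `c` on pairs of vectors of equal norm.
  have hpol : ∀ x y, 2 * inner ℝ x (A y) ≤ c * (‖x‖ ^ 2 + ‖y‖ ^ 2) := by
    intro x y
    have h1 := (abs_le.1 (hform (x + y))).2
    have h2 := (abs_le.1 (hform (x - y))).1
    have h3 := hA x y
    have h4 := parallelogram_law_with_norm ℝ x y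
    simp only [map_add, map_sub, inner_add_left, inner_add_right, inner_sub_left,
      inner_sub_right] at h1 h2
    have h5 : c * (‖x + y‖ ^ 2 + ‖x - y‖ ^ 2) = c * (2 * (‖x‖ ^ 2 + ‖y‖ ^ 2)) := by rw [h4]
    linarith
  refine A.opNorm_le_bound hc fun y => ?_
  rcases eq_or_ne (A y) 0 with h0 | h0
  · rw [h0, norm_zero]; positivity
  have hpos : 0 < ‖A y‖ := norm_pos_iff.2 h0
  have h := hpol ((‖y‖ / ‖A y‖) • A y) y
  rw [inner_smul_left, RCLike.conj_to_real, real_inner_self_eq_norm_sq, norm_smul,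
    Real.norm_of_nonneg (by positivity), div_mul_cancel₀ _ hpos.ne'] at h
  have e : ‖y‖ / ‖A y‖ * ‖A y‖ ^ 2 = ‖y‖ * ‖A y‖ := by field_simp
  rw [e] at h
  rcases (norm_nonneg y).eq_or_lt with hy | hy
  · rw [norm_eq_zero.1 hy.symm] at h0
    simp at h0
  · nlinarith

/-- The spectral gap of the lazy Metropolis matrix is at least `1 / (12 n²)`. -/
theorem sigma_lazyMetropolis_le {𝒢 : SimpleGraph (Fin n)} [DecidableRel 𝒢.Adj]
    (h𝒢 : 𝒢.Connected) : sigma (lazyMetropolis 𝒢) ≤ 1 - 1 / (12 * (n : ℝ) ^ 2) := by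
  have := h𝒢.nonempty
  have hn : 1 ≤ n := Fin.pos_iff_nonempty.2 this
  have hnR : (1 : ℝ) ≤ n := by exact_mod_cast hn
  have hn2 : 1 / (12 * (n : ℝ) ^ 2) ≤ 1 := by
    rw [div_le_one (by positivity)]; nlinarith
  set W := lazyMetropolis 𝒢 with hWdef
  have hform : ∀ x y : EuclideanSpace ℝ (Fin n), inner ℝ x (Matrix.toEuclideanCLM (𝕜 := ℝ)
      (W - Matrix.of fun _ _ => 1 / (n : ℝ)) y)
      = ∑ i, ∑ j, W i j * (x i * y j) - (∑ i, x i) * (∑ j, y j) / n := by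
    intro x y
    rw [Matrix.inner_toEuclideanCLM]
    simp only [dotProduct, Matrix.mulVec, Matrix.sub_apply, Matrix.of_apply, sub_mul,
      Finset.sum_sub_distrib, mul_sub]
    congr 1
    · exact Finset.sum_congr rfl fun i _ => by
        rw [Finset.mul_sum]; exact Finset.sum_congr rfl fun j _ => by ring
    · rw [← Finset.sum_mul, ← Finset.mul_sum]; ring
  refine opNorm_le_of_abs_inner_self_le _ ?_ (by linarith) ?_
  · intro x y
    rw [hform, hform, Finset.sum_comm, mul_comm (∑ i, x i)]
    congr 1
    exact Finset.sum_congr rfl fun i _ => Finset.sum_congr rfl fun j _ => by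
      rw [hWdef, lazyMetropolis_isSymm]; ring
  · intro x
    rw [hform]
    set m := (∑ i, x i) / n with hm
    let v : Fin n → ℝ := fun i => x i - m
    have hxs : ∑ i, x i = n * m := by rw [hm]; field_simp
    have hv : ∑ i, v i = 0 := by
      simp [v, Finset.sum_sub_distrib, hxs]
    have hnorm : ∑ i, v i ^ 2 = ‖x‖ ^ 2 - n * m ^ 2 := by
      simp only [v, sub_sq, Finset.sum_add_distrib, Finset.sum_sub_distrib,
        EuclideanSpace.real_norm_sq_eq, ← Finset.mul_sum, ← Finset.sum_mul, hxs,
        Finset.sum_const, Finset.card_univ, Fintype.card_fin, nsmul_eq_mul]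
      ring
    have hdv : dirichlet W v = dirichlet W x := by
      simp [dirichlet, v]
    have hD := dirichlet_eq (lazyMetropolis_isSymm 𝒢) (lazyMetropolis_sum_row 𝒢) x
    rw [← EuclideanSpace.real_norm_sq_eq, ← hWdef] at hD
    have hP := sum_sq_le_dirichlet h𝒢 hv
    have hL := dirichlet_lazyMetropolis_le 𝒢 v
    rw [← hWdef, hdv, hnorm] at hP hL
    have e : ∑ i, ∑ j, W i j * (x i * x j) - (∑ i, x i) * (∑ j, x j) / n
        = ‖x‖ ^ 2 - n * m ^ 2 - dirichlet W x / 2 := by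
      rw [hxs, hD]; field_simp; ring
    rw [e]
    have hP' : 1 / (12 * (n : ℝ) ^ 2) * (‖x‖ ^ 2 - n * m ^ 2) ≤ dirichlet W x / 2 := by
      rw [one_div, inv_mul_le_iff₀ (by positivity)]
      linarith
    have hnn : 0 ≤ ‖x‖ ^ 2 - n * m ^ 2 := by rw [← hnorm]; positivity
    have hm2 : 0 ≤ n * m ^ 2 := by positivity
    have h0 : 0 ≤ 1 - 1 / (12 * (n : ℝ) ^ 2) := by linarith
    rw [abs_of_nonneg (by linarith)]
    nlinarith

end LazyMetropolis

/-! ### Stacked vectors and the error recursions -/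

section Stacked

variable {n N : ℕ} (v w : Fin n → EuclideanSpace ℝ (Fin N))

theorem frob_eq_norm :
    frob v = ‖(WithLp.toLp 2 v : PiLp 2 fun _ : Fin n => EuclideanSpace ℝ (Fin N))‖ := by
  rw [PiLp.norm_eq_of_L2, frob]

theorem frob_nonneg : 0 ≤ frob v := Real.sqrt_nonneg _

theorem frob_sq : frob v ^ 2 = ∑ i, ‖v i‖ ^ 2 :=
  Real.sq_sqrt (Finset.sum_nonneg fun _ _ => sq_nonneg _)

theorem frob_add_le : frob (fun i => v i + w i) ≤ frob v + frob w := by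
  simp only [frob_eq_norm]
  exact norm_add_le (WithLp.toLp 2 v : PiLp 2 fun _ : Fin n => EuclideanSpace ℝ (Fin N))
    (WithLp.toLp 2 w)

theorem frob_sub_le : frob (fun i => v i - w i) ≤ frob v + frob w := by
  simp only [frob_eq_norm]
  exact norm_sub_le (WithLp.toLp 2 v : PiLp 2 fun _ : Fin n => EuclideanSpace ℝ (Fin N))
    (WithLp.toLp 2 w)

theorem norm_le_frob (i : Fin n) : ‖v i‖ ≤ frob v := by
  rw [frob_eq_norm]
  exact PiLp.norm_apply_le
    (WithLp.toLp 2 v : PiLp 2 fun _ : Fin n => EuclideanSpace ℝ (Fin N)) i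

variable {v w} in
theorem frob_le_of_norm_le {c : ℝ} (hc : 0 ≤ c) (h : ∀ i, ‖v i‖ ≤ c * ‖w i‖) :
    frob v ≤ c * frob w := by
  refine abs_le_of_sq_le_sq' ?_ (mul_nonneg hc (frob_nonneg w)) |>.2
  rw [mul_pow, frob_sq, frob_sq, Finset.mul_sum]
  refine Finset.sum_le_sum fun i _ => ?_
  rw [← mul_pow]
  exact pow_le_pow_left₀ (norm_nonneg _) (h i) 2

theorem frob_smul {c : ℝ} (hc : 0 ≤ c) : frob (fun i => c • v i) ≤ c * frob v :=
  frob_le_of_norm_le hc fun i => by rw [norm_smul, Real.norm_of_nonneg hc]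

theorem frob_const_sq (c : EuclideanSpace ℝ (Fin N)) :
    frob (fun _ : Fin n => c) ^ 2 = n * ‖c‖ ^ 2 := by
  simp [frob_sq]

theorem frob_const (c : EuclideanSpace ℝ (Fin N)) :
    frob (fun _ : Fin n => c) = Real.sqrt n * ‖c‖ := by
  rw [← abs_of_nonneg (frob_nonneg _), ← Real.sqrt_sq_eq_abs, frob_const_sq,
    Real.sqrt_mul (Nat.cast_nonneg n), Real.sqrt_sq (norm_nonneg _)]

theorem sum_eq_smul_avg (hn : 0 < n) : ∑ i, v i = (n : ℝ) • avg v := by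
  have : (n : ℝ) ≠ 0 := by exact_mod_cast hn.ne'
  rw [avg, smul_smul, mul_one_div_cancel this, one_smul]

theorem avg_add : avg (fun i => v i + w i) = avg v + avg w := by
  simp only [avg, Finset.sum_add_distrib, smul_add]

theorem avg_sub : avg (fun i => v i - w i) = avg v - avg w := by
  simp only [avg, Finset.sum_sub_distrib, smul_sub]

theorem avg_smul (c : ℝ) : avg (fun i => c • v i) = c • avg v := by
  simp only [avg, ← Finset.smul_sum, smul_comm c]

/-- Orthogonal decomposition of a stacked vector into its average and its deviation. -/
theorem frob_sub_avg_sq (hn : 0 < n) :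
    frob (fun i => v i - avg v) ^ 2 + n * ‖avg v‖ ^ 2 = frob v ^ 2 := by
  have h : ∑ i, inner ℝ (v i) (avg v) = n * ‖avg v‖ ^ 2 := by
    rw [← sum_inner, sum_eq_smul_avg v hn, inner_smul_left, real_inner_self_eq_norm_sq]
    simp
  simp only [frob_sq, norm_sub_sq_real, Finset.sum_add_distrib, Finset.sum_sub_distrib,
    ← Finset.mul_sum, h, Finset.sum_const, Finset.card_univ, Fintype.card_fin, nsmul_eq_mul]
  ring

theorem frob_sub_avg_le (hn : 0 < n) : frob (fun i => v i - avg v) ≤ frob v := by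
  refine abs_le_of_sq_le_sq' ?_ (frob_nonneg v) |>.2
  rw [← frob_sub_avg_sq v hn]
  have : 0 ≤ n * ‖avg v‖ ^ 2 := by positivity
  linarith

theorem sqrt_mul_norm_avg_le (hn : 0 < n) : Real.sqrt n * ‖avg v‖ ≤ frob v := by
  refine abs_le_of_sq_le_sq' ?_ (frob_nonneg v) |>.2
  rw [← frob_sub_avg_sq v hn, mul_pow, Real.sq_sqrt (Nat.cast_nonneg n)]
  have := sq_nonneg (frob (fun i => v i - avg v))
  linarith

/-- A matrix acting on the agent index is bounded in Frobenius norm by its spectral norm. -/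
theorem frob_mulVec_le (A : Matrix (Fin n) (Fin n) ℝ) :
    frob (fun i => ∑ j, A i j • v j)
      ≤ ‖Matrix.toEuclideanCLM (n := Fin n) (𝕜 := ℝ) A‖ * frob v := by
  set c := ‖Matrix.toEuclideanCLM (n := Fin n) (𝕜 := ℝ) A‖
  refine abs_le_of_sq_le_sq' ?_ (mul_nonneg (norm_nonneg _) (frob_nonneg v)) |>.2
  rw [mul_pow, frob_sq, frob_sq]
  simp only [EuclideanSpace.real_norm_sq_eq]
  rw [Finset.sum_comm, Finset.sum_comm (s := Finset.univ) (t := Finset.univ)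
    (f := fun i k => v i k ^ 2), Finset.mul_sum]
  -- The bound holds for each of the `N` columns separately.
  refine Finset.sum_le_sum fun k _ => ?_
  have h := (Matrix.toEuclideanCLM (n := Fin n) (𝕜 := ℝ) A).le_opNorm
    (WithLp.toLp 2 fun j => v j k)
  have h2 := pow_le_pow_left₀ (norm_nonneg _) h 2
  rw [mul_pow, EuclideanSpace.real_norm_sq_eq, EuclideanSpace.real_norm_sq_eq] at h2
  simpa [Matrix.mulVec, dotProduct] using h2

variable {W : Matrix (Fin n) (Fin n) ℝ}

/-- Mixing contracts the deviation from the average by the factor `σ`. -/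
theorem frob_mix_sub_avg_le (hn : 0 < n) (hrow : ∀ i, ∑ j, W i j = 1) :
    frob (fun i => (∑ j, W i j • v j) - avg v) ≤ sigma W * frob (fun i => v i - avg v) := by
  have hn' : (n : ℝ) ≠ 0 := by exact_mod_cast hn.ne'
  have h := frob_mulVec_le (fun i => v i - avg v) (W - Matrix.of fun _ _ => 1 / (n : ℝ))
  refine le_trans (le_of_eq ?_) h
  congr 1
  ext1 i
  simp only [Matrix.sub_apply, Matrix.of_apply, sub_smul, smul_sub, Finset.sum_sub_distrib,
    ← Finset.sum_smul, hrow, one_smul, ← Finset.smul_sum]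
  rw [show (1 / (n : ℝ)) • ∑ j, v j = avg v from rfl]
  simp [hn']

theorem avg_mix (hsymm : ∀ i j, W i j = W j i) (hrow : ∀ i, ∑ j, W i j = 1) :
    avg (fun i => ∑ j, W i j • v j) = avg v := by
  rw [avg, avg, Finset.sum_comm]
  congr 1
  refine Finset.sum_congr rfl fun j _ => ?_
  rw [← Finset.sum_smul]
  simp_rw [fun i => hsymm i j]
  rw [hrow, one_smul]

end Stacked

section Objective

variable {n N : ℕ} {f : Fin n → EuclideanSpace ℝ (Fin N) → ℝ} {β : ℝ}

theorem hasFDerivAt_objective (hf : ∀ i, Differentiable ℝ (f i)) (y : EuclideanSpace ℝ (Fin N)) :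
    HasFDerivAt (objective f) ((1 / (n : ℝ)) • ∑ i, fderiv ℝ (f i) y) y :=
  (HasFDerivAt.fun_sum fun i _ => (hf i y).hasFDerivAt).const_mul _

theorem differentiable_objective (hf : ∀ i, Differentiable ℝ (f i)) :
    Differentiable ℝ (objective f) := fun y => (hasFDerivAt_objective hf y).differentiableAt

theorem gradient_objective (hf : ∀ i, Differentiable ℝ (f i)) (y : EuclideanSpace ℝ (Fin N)) :
    gradient (objective f) y = avg fun i => gradient (f i) y := by
  rw [gradient, (hasFDerivAt_objective hf y).fderiv, avg]
  simp [gradient]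

theorem gradient_objective_eq_zero {xstar : EuclideanSpace ℝ (Fin N)}
    (h : ∀ y, objective f xstar ≤ objective f y) : gradient (objective f) xstar = 0 := by
  have : IsLocalMin (objective f) xstar := Eventually.of_forall h
  rw [gradient, this.fderiv_eq_zero, map_zero]

theorem isSmooth_objective (hn : 0 < n) (hf : ∀ i, IsSmooth β (f i)) :
    IsSmooth β (objective f) := by
  have hd := fun i => (hf i).1
  refine ⟨differentiable_objective hd, fun x y => ?_⟩
  have hn' : (0 : ℝ) < n := by exact_mod_cast hn
  rw [gradient_objective hd, gradient_objective hd, ← avg_sub, avg, norm_smul,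
    Real.norm_of_nonneg (by positivity), one_div, inv_mul_le_iff₀ hn']
  calc _ ≤ ∑ i, ‖gradient (f i) x - gradient (f i) y‖ := norm_sum_le _ _
    _ ≤ ∑ _i : Fin n, β * ‖x - y‖ := Finset.sum_le_sum fun i _ => (hf i).2 x y
    _ = _ := by simp

theorem convexOn_objective (hf : ∀ i, ConvexOn ℝ univ (f i)) :
    ConvexOn ℝ univ (objective f) := by
  refine ⟨convex_univ, fun x _ y _ a b ha hb hab => ?_⟩
  have h := Finset.sum_le_sum fun i (_ : i ∈ Finset.univ) =>
    (hf i).2 (mem_univ x) (mem_univ y) ha hb hab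
  simp only [smul_eq_mul, Finset.sum_add_distrib, ← Finset.mul_sum] at h
  have h2 := mul_le_mul_of_nonneg_left h (show 0 ≤ 1 / (n : ℝ) by positivity)
  simp only [objective, smul_eq_mul]
  linarith

theorem isStronglyConvex_objective (hn : 0 < n) {α : ℝ} (hd : ∀ i, Differentiable ℝ (f i))
    (hf : ∀ i, IsStronglyConvex α (f i)) : IsStronglyConvex α (objective f) := by
  intro x y
  have hn' : (n : ℝ) ≠ 0 := by exact_mod_cast hn.ne'
  have h := Finset.sum_le_sum fun i (_ : i ∈ Finset.univ) => hf i x y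
  simp only [Finset.sum_add_distrib, Finset.sum_const, Finset.card_univ, Fintype.card_fin,
    nsmul_eq_mul] at h
  have h2 := mul_le_mul_of_nonneg_left h (show 0 ≤ 1 / (n : ℝ) by positivity)
  rw [gradient_objective hd, avg, inner_smul_left, sum_inner]
  simp only [objective, RCLike.conj_to_real]
  have e : 1 / (n : ℝ) * (∑ i, f i x + ∑ i, inner ℝ (gradient (f i) x) (y - x)
      + n * (α / 2 * ‖y - x‖ ^ 2)) = 1 / (n : ℝ) * ∑ i, f i x
      + 1 / (n : ℝ) * ∑ i, inner ℝ (gradient (f i) x) (y - x) + α / 2 * ‖y - x‖ ^ 2 := by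
    field_simp
  linarith

end Objective

section Iterates

variable {n N : ℕ} {W : Matrix (Fin n) (Fin n) ℝ} {f : Fin n → EuclideanSpace ℝ (Fin N) → ℝ}
  {β η : ℝ} {x0 : Fin n → EuclideanSpace ℝ (Fin N)}

theorem xIter_succ (t : ℕ) (i : Fin n) : xIter W f η x0 (t + 1) i
    = (∑ j, W i j • xIter W f η x0 t j) - η • sIter W f η x0 t i := rfl

theorem sIter_succ (t : ℕ) (i : Fin n) : sIter W f η x0 (t + 1) i
    = (∑ j, W i j • sIter W f η x0 t j) + gradient (f i) (xIter W f η x0 (t + 1) i)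
      - gradient (f i) (xIter W f η x0 t i) := rfl

/-- Gradient tracking: the average of the `s_i(t)` is the average of the current gradients. -/
theorem avg_sIter (hsymm : ∀ i j, W i j = W j i) (hrow : ∀ i, ∑ j, W i j = 1) (t : ℕ) :
    avg (sIter W f η x0 t) = gAvg W f η x0 t := by
  induction t with
  | zero => rfl
  | succ t ih =>
    have : sIter W f η x0 (t + 1) = fun i => (∑ j, W i j • sIter W f η x0 t j)
      + gradient (f i) (xIter W f η x0 (t + 1) i) - gradient (f i) (xIter W f η x0 t i) := rfl
    rw [this, avg_sub, avg_add, avg_mix _ hsymm hrow, ih]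
    simp only [gAvg]
    abel

theorem xBar_succ (hsymm : ∀ i j, W i j = W j i) (hrow : ∀ i, ∑ j, W i j = 1) (t : ℕ) :
    xBar W f η x0 (t + 1) = xBar W f η x0 t - η • gAvg W f η x0 t := by
  have : xIter W f η x0 (t + 1) = fun i => (∑ j, W i j • xIter W f η x0 t j)
      - η • sIter W f η x0 t i := rfl
  rw [xBar, this, avg_sub, avg_mix _ hsymm hrow, avg_smul, avg_sIter hsymm hrow, xBar]

theorem consErr_succ_le (hn : 0 < n) (hsymm : ∀ i j, W i j = W j i)
    (hrow : ∀ i, ∑ j, W i j = 1) (hη : 0 ≤ η) (t : ℕ) :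
    consErr W f η x0 (t + 1)
      ≤ sigma W * consErr W f η x0 t + η * gradErr W f η x0 t := by
  have e : (fun i => xIter W f η x0 (t + 1) i - xBar W f η x0 (t + 1))
      = fun i => ((∑ j, W i j • xIter W f η x0 t j) - xBar W f η x0 t)
        - η • (sIter W f η x0 t i - gAvg W f η x0 t) := by
    ext1 i
    rw [xIter_succ, xBar_succ hsymm hrow, smul_sub]
    abel
  rw [consErr, e]
  exact (frob_sub_le _ _).trans
    (add_le_add (frob_mix_sub_avg_le _ hn hrow) (frob_smul _ hη))

theorem frob_xIter_succ_sub_le (hn : 0 < n) (hrow : ∀ i, ∑ j, W i j = 1) (hσ : sigma W ≤ 1)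
    (hη : 0 ≤ η) (t : ℕ) :
    frob (fun i => xIter W f η x0 (t + 1) i - xIter W f η x0 t i)
      ≤ 2 * consErr W f η x0 t + η * gradErr W f η x0 t
        + η * (Real.sqrt n * ‖gAvg W f η x0 t‖) := by
  have e : (fun i => xIter W f η x0 (t + 1) i - xIter W f η x0 t i)
      = fun i => ((((∑ j, W i j • xIter W f η x0 t j) - xBar W f η x0 t)
        - (xIter W f η x0 t i - xBar W f η x0 t))
        - η • (sIter W f η x0 t i - gAvg W f η x0 t)) - η • gAvg W f η x0 t := by
    ext1 i
    rw [xIter_succ, smul_sub]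
    abel
  have h1 := frob_mix_sub_avg_le (xIter W f η x0 t) hn hrow
  have h2 : sigma W * consErr W f η x0 t ≤ 1 * consErr W f η x0 t :=
    mul_le_mul_of_nonneg_right hσ (frob_nonneg _)
  have h3 := frob_sub_le (fun i => (∑ j, W i j • xIter W f η x0 t j) - xBar W f η x0 t)
    (fun i => xIter W f η x0 t i - xBar W f η x0 t)
  have h4 := frob_sub_le (fun i => ((∑ j, W i j • xIter W f η x0 t j) - xBar W f η x0 t)
    - (xIter W f η x0 t i - xBar W f η x0 t))
    (fun i => η • (sIter W f η x0 t i - gAvg W f η x0 t))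
  have h5 := frob_sub_le (fun i => (((∑ j, W i j • xIter W f η x0 t j) - xBar W f η x0 t)
    - (xIter W f η x0 t i - xBar W f η x0 t))
    - η • (sIter W f η x0 t i - gAvg W f η x0 t)) (fun _ => η • gAvg W f η x0 t)
  have h6 := frob_smul (fun i => sIter W f η x0 t i - gAvg W f η x0 t) hη
  have h7 := frob_smul (fun _ : Fin n => gAvg W f η x0 t) hη
  rw [frob_const (gAvg W f η x0 t)] at h7
  rw [e]
  simp only [consErr, gradErr, xBar] at *
  linarith

/-- Besides the contraction by mixing, the tracking error picks up the change of the local gradients,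
which is at most `β` times the movement of the iterates. -/
theorem gradErr_succ_le (hn : 0 < n) (hsymm : ∀ i j, W i j = W j i)
    (hrow : ∀ i, ∑ j, W i j = 1) (hσ : sigma W ≤ 1) (hη : 0 ≤ η) (hβ : 0 ≤ β)
    (hf : ∀ i, IsSmooth β (f i)) (t : ℕ) :
    gradErr W f η x0 (t + 1) ≤ (sigma W + β * η) * gradErr W f η x0 t
      + 2 * β * consErr W f η x0 t + β * η * (Real.sqrt n * ‖gAvg W f η x0 t‖) := by
  let Δ : Fin n → EuclideanSpace ℝ (Fin N) := fun i =>
    gradient (f i) (xIter W f η x0 (t + 1) i) - gradient (f i) (xIter W f η x0 t i)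
  have hΔ : avg Δ = gAvg W f η x0 (t + 1) - gAvg W f η x0 t := avg_sub _ _
  have e : (fun i => sIter W f η x0 (t + 1) i - gAvg W f η x0 (t + 1))
      = fun i => ((∑ j, W i j • sIter W f η x0 t j) - avg (sIter W f η x0 t))
        + (Δ i - avg Δ) := by
    ext1 i
    rw [sIter_succ, hΔ, avg_sIter hsymm hrow]
    simp only [Δ]
    abel
  have h1 := frob_mix_sub_avg_le (sIter W f η x0 t) hn hrow
  have h2 := frob_sub_avg_le Δ hn
  have h3 : frob Δ ≤ β * frob (fun i => xIter W f η x0 (t + 1) i - xIter W f η x0 t i) :=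
    frob_le_of_norm_le hβ fun i => (hf i).2 _ _
  have h4 := mul_le_mul_of_nonneg_left
    (frob_xIter_succ_sub_le (f := f) (x0 := x0) hn hrow hσ hη t) hβ
  have h5 := frob_add_le (fun i => (∑ j, W i j • sIter W f η x0 t j) - avg (sIter W f η x0 t))
    (fun i => Δ i - avg Δ)
  rw [gradErr, e]
  rw [avg_sIter hsymm hrow] at h1 h5 ⊢
  simp only [gradErr] at *
  linarith

theorem sqrt_mul_norm_gAvg_sub_le (hn : 0 < n) (hβ : 0 ≤ β) (hf : ∀ i, IsSmooth β (f i)) (t : ℕ) :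
    Real.sqrt n * ‖gAvg W f η x0 t - gradient (objective f) (xBar W f η x0 t)‖
      ≤ β * consErr W f η x0 t := by
  rw [gradient_objective fun i => (hf i).1, gAvg, ← avg_sub]
  exact (sqrt_mul_norm_avg_le _ hn).trans (frob_le_of_norm_le hβ fun i => (hf i).2 _ _)

variable {xstar : EuclideanSpace ℝ (Fin N)}

theorem sqrt_mul_norm_gAvg_le (hn : 0 < n) (hβ : 0 ≤ β) (hf : ∀ i, IsSmooth β (f i))
    (hxstar : ∀ y, objective f xstar ≤ objective f y) (t : ℕ) :
    Real.sqrt n * ‖gAvg W f η x0 t‖ ≤ β * consErr W f η x0 t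
      + β * (Real.sqrt n * ‖xBar W f η x0 t - xstar‖) := by
  have h1 := sqrt_mul_norm_gAvg_sub_le (W := W) (η := η) (x0 := x0) hn hβ hf t
  have h2 := (isSmooth_objective hn hf).2 (xBar W f η x0 t) xstar
  rw [gradient_objective_eq_zero hxstar, sub_zero] at h2
  have h3 := norm_le_norm_sub_add (gAvg W f η x0 t) (gradient (objective f) (xBar W f η x0 t))
  have h4 := mul_le_mul_of_nonneg_left (h3.trans (add_le_add_right h2 _)) (Real.sqrt_nonneg n)
  linarith

/-- The averaged iterate performs a gradient step on the objective, up to an error caused by the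
disagreement of the agents. -/
theorem sqrt_mul_norm_xBar_succ_sub_le (hn : 0 < n) (hsymm : ∀ i j, W i j = W j i)
    (hrow : ∀ i, ∑ j, W i j = 1) (hη : 0 < η) (hβ : 0 ≤ β)
    (hf : ∀ i, IsSmooth β (f i)) {α : ℝ} (hsc : ∀ i, IsStronglyConvex α (f i)) (hαβ : α ≤ β)
    (hη2 : η * (α + β) ≤ 2) (hxstar : ∀ y, objective f xstar ≤ objective f y) (t : ℕ) :
    Real.sqrt n * ‖xBar W f η x0 (t + 1) - xstar‖ ≤ η * β * consErr W f η x0 t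
      + |1 - α * η| * (Real.sqrt n * ‖xBar W f η x0 t - xstar‖) := by
  have hs := isSmooth_objective hn hf
  have h1 := norm_gradient_step_le (φ := objective f) (G := gradient (objective f)) hαβ hη hη2
    (isStronglyConvex_objective hn (fun i => (hf i).1) hsc)
    (le_add_inner_gradient_add_sq hs.1 hs.2) (xBar W f η x0 t) xstar
  rw [gradient_objective_eq_zero hxstar, sub_zero] at h1
  have h2 := sqrt_mul_norm_gAvg_sub_le (W := W) (η := η) (x0 := x0) hn hβ hf t
  have e : xBar W f η x0 (t + 1) - xstar
      = (xBar W f η x0 t - xstar - η • gradient (objective f) (xBar W f η x0 t))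
        - η • (gAvg W f η x0 t - gradient (objective f) (xBar W f η x0 t)) := by
    rw [xBar_succ hsymm hrow, smul_sub]
    abel
  have h3 := norm_sub_le
    (xBar W f η x0 t - xstar - η • gradient (objective f) (xBar W f η x0 t))
    (η • (gAvg W f η x0 t - gradient (objective f) (xBar W f η x0 t)))
  rw [← e, norm_smul, Real.norm_of_nonneg hη.le] at h3
  have h4 := mul_le_mul_of_nonneg_left (h3.trans (add_le_add_left h1 _)) (Real.sqrt_nonneg n)
  have h5 := mul_le_mul_of_nonneg_left h2 hη.le
  linarith

end Iterates

/-! ### The Perron root of the error matrix -/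

section Perron

variable {m : ℕ} {A : Matrix (Fin m) (Fin m) ℝ} {v : Fin m → ℝ} {r : ℝ}

/-- A positive eigenvector of a nonnegative matrix belongs to its spectral radius. -/
theorem rho_eq_of_pos_eigenvector [NeZero m] (hA : ∀ i j, 0 ≤ A i j) (hv : ∀ i, 0 < v i)
    (h : A.mulVec v = r • v) : rho A = r := by
  have hr : 0 ≤ r := by
    have h0 := congrFun h 0
    simp only [Matrix.mulVec, dotProduct, Pi.smul_apply, smul_eq_mul] at h0
    have : 0 ≤ r * v 0 := by
      rw [← h0]
      exact Finset.sum_nonneg fun j _ => mul_nonneg (hA 0 j) (hv j).le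
    exact nonneg_of_mul_nonneg_left this (hv 0)
  have hspec : ∀ k : ℂ, k ∈ spectrum ℂ (A.map (fun r : ℝ => (r : ℂ))) ↔
      ∃ z : Fin m → ℂ, z ≠ 0 ∧ (A.map (fun r : ℝ => (r : ℂ))).mulVec z = k • z := by
    intro k
    rw [← Matrix.spectrum_toLin', ← Module.End.hasEigenvalue_iff_mem_spectrum]
    constructor
    · intro hk
      obtain ⟨z, hz⟩ := hk.exists_hasEigenvector
      exact ⟨z, hz.2, by simpa using hz.apply_eq_smul⟩
    · rintro ⟨z, hz, hz2⟩
      exact Module.End.hasEigenvalue_of_hasEigenvector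
        ⟨Module.End.mem_eigenspace_iff.2 (by simpa using hz2), hz⟩
  -- Comparison in the maximum norm weighted by `v`.
  have hle : ∀ k ∈ spectrum ℂ (A.map (fun r : ℝ => (r : ℂ))), ‖k‖ ≤ r := by
    intro k hk
    obtain ⟨z, hz0, hz⟩ := (hspec k).1 hk
    obtain ⟨i, hi⟩ := Finite.exists_max fun i => ‖z i‖ / v i
    set M := ‖z i‖ / v i with hM
    have hzi : ‖z i‖ = M * v i := (div_mul_cancel₀ _ (hv i).ne').symm
    have hzM : ∀ j, ‖z j‖ ≤ M * v j := fun j => (div_le_iff₀ (hv j)).1 (hi j)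
    have hMpos : 0 < M := by
      obtain ⟨j, hj⟩ := Function.ne_iff.1 hz0
      exact (div_pos (norm_pos_iff.2 hj) (hv j)).trans_le (hi j)
    have e1 := congrFun hz i
    have e2 := congrFun h i
    simp only [Matrix.mulVec, dotProduct, Pi.smul_apply, smul_eq_mul, Matrix.map_apply] at e1 e2
    have h1 : ‖k‖ * (M * v i) ≤ r * (M * v i) := by
      calc ‖k‖ * (M * v i) = ‖∑ j, (A i j : ℂ) * z j‖ := by rw [e1, norm_mul, hzi]
        _ ≤ ∑ j, A i j * (M * v j) := by
            refine norm_sum_le_of_le _ fun j _ => ?_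
            rw [norm_mul, Complex.norm_real, Real.norm_of_nonneg (hA i j)]
            exact mul_le_mul_of_nonneg_left (hzM j) (hA i j)
        _ = M * ∑ j, A i j * v j := by
            rw [Finset.mul_sum]
            exact Finset.sum_congr rfl fun j _ => by ring
        _ = r * (M * v i) := by rw [e2]; ring
    exact le_of_mul_le_mul_right h1 (mul_pos hMpos (hv i))
  have hmem : (r : ℂ) ∈ spectrum ℂ (A.map (fun r : ℝ => (r : ℂ))) := by
    refine (hspec r).2 ⟨fun i => (v i : ℂ), ?_, ?_⟩
    · intro h0
      have := congrFun h0 0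
      simp only [Pi.zero_apply, Complex.ofReal_eq_zero] at this
      exact (hv 0).ne' this
    · ext i
      have e2 := congrFun h i
      simp only [Matrix.mulVec, dotProduct, Pi.smul_apply, smul_eq_mul, Matrix.map_apply] at e2 ⊢
      exact_mod_cast congrArg (fun r : ℝ => (r : ℂ)) e2
  have : spectralRadius ℂ (A.map (fun r : ℝ => (r : ℂ))) = ENNReal.ofReal r := by
    refine le_antisymm (iSup₂_le fun k hk => ?_) ?_
    · rw [← ENNReal.ofReal_coe_nnreal, coe_nnnorm]
      exact ENNReal.ofReal_le_ofReal (hle k hk)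
    · refine le_trans (le_of_eq ?_)
        (le_iSup₂ (f := fun (k : ℂ) (_ : k ∈ spectrum ℂ _) => (‖k‖₊ : ENNReal)) (r : ℂ) hmem)
      rw [← ENNReal.ofReal_coe_nnreal, coe_nnnorm, Complex.norm_real, Real.norm_of_nonneg hr]
  rw [rho, this, ENNReal.toReal_ofReal hr]

/-- A nonnegative linear recursion with a positive eigenvector grows at most like the powers of
its eigenvalue, without any loss in the rate. -/
theorem exists_le_mul_pow_of_le_mulVec (hA : ∀ i j, 0 ≤ A i j) (hv : ∀ i, 0 < v i)
    (h : A.mulVec v = r • v) {z : ℕ → Fin m → ℝ} (hz : ∀ t i, z (t + 1) i ≤ A.mulVec (z t) i) :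
    ∃ C, ∀ t i, z t i ≤ C * r ^ t * v i := by
  refine ⟨∑ j, |z 0 j| / v j, fun t => ?_⟩
  induction t with
  | zero =>
    intro i
    have h1 : |z 0 i| / v i ≤ ∑ j, |z 0 j| / v j :=
      Finset.single_le_sum (f := fun j => |z 0 j| / v j)
        (fun j _ => div_nonneg (abs_nonneg _) (hv j).le) (Finset.mem_univ i)
    rw [div_le_iff₀ (hv i)] at h1
    rw [pow_zero, mul_one]
    exact (le_abs_self _).trans h1
  | succ t ih =>
    intro i
    set C := ∑ j, |z 0 j| / v j
    have e := congrFun h i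
    simp only [Matrix.mulVec, dotProduct, Pi.smul_apply, smul_eq_mul] at e
    calc z (t + 1) i ≤ ∑ j, A i j * z t j := hz t i
      _ ≤ ∑ j, A i j * (C * r ^ t * v j) :=
          Finset.sum_le_sum fun j _ => mul_le_mul_of_nonneg_left (ih j) (hA i j)
      _ = C * r ^ t * ∑ j, A i j * v j := by
          rw [Finset.mul_sum]
          exact Finset.sum_congr rfl fun j _ => by ring
      _ = _ := by rw [e]; ring

end Perron

/-- For `η = (α / β²) ε²` and `σ ≤ 1 - 6 ε`, the Perron root of `G(η)` is at most
`1 - (α ε / β)² / 2`, and it has a positive eigenvector. -/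
theorem exists_pos_eigenvector_Gmat {σ α β ε η : ℝ} (hα : 0 < α) (hαβ : α ≤ β) (hε : 0 < ε)
    (hσ : σ ≤ 1 - 6 * ε) (hσ0 : 0 ≤ σ) (hη : η = α / β ^ 2 * ε ^ 2) :
    ∃ (r : ℝ) (v : Fin 3 → ℝ), (∀ i, 0 < v i) ∧ (Gmat σ α β η).mulVec v = r • v ∧
      0 < r ∧ r ≤ 1 - 1 / 2 * (α / β * ε) ^ 2 := by
  have hβ : 0 < β := hα.trans_le hαβ
  set κ := α / β with hκ
  have hκ0 : 0 < κ := div_pos hα hβ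
  have hκ1 : κ ≤ 1 := (div_le_one hβ).2 hαβ
  have hε1 : ε ≤ 1 / 6 := by linarith
  obtain ⟨b, hb⟩ : ∃ b, b = κ * ε ^ 2 := ⟨_, rfl⟩
  have hη0 : 0 < η := by rw [hη]; positivity
  have hβη : β * η = b := by rw [hη, hb, hκ]; field_simp
  have hαη : α * η = κ * b := by rw [hη, hb, hκ]; field_simp
  have hε2 : ε ^ 2 ≤ ε / 6 := by nlinarith
  have hb0 : 0 < b := by rw [hb]; positivity
  have hbε : b ≤ ε ^ 2 := by rw [hb]; nlinarith [sq_nonneg ε]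
  have hκb : κ * b ≤ b := by nlinarith
  have hκb0 : 0 < κ * b := mul_pos hκ0 hb0
  have hb1 : b ≤ 1 := by linarith
  have hlam : max |1 - α * η| |1 - β * η| = 1 - κ * b := by
    rw [hαη, hβη, abs_of_nonneg (by linarith), abs_of_nonneg (by linarith), max_eq_left]
    linarith
  have hR : 1 / 2 * (κ * ε) ^ 2 = κ * b / 2 := by rw [hb]; ring
  rw [hR]
  obtain ⟨l, hl⟩ : ∃ l, l = 1 - κ * b := ⟨_, rfl⟩
  rw [← hl] at hlam
  -- Up to the factor `r - l`, the characteristic equation of `G(η)`.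
  let F : ℝ → ℝ := fun r => (r - σ - b) * (r - σ) * (r - l) - b * (b + 2) * (r - l) - b ^ 3
  have hF0 : F l ≤ 0 := by
    have : 0 < b ^ 3 := by positivity
    simp only [F, sub_self, mul_zero]; linarith
  have hF1 : 0 ≤ F (1 - κ * b / 2) := by
    have h1 : 5 * ε ≤ 1 - κ * b / 2 - σ - b := by linarith
    have h2 : 5 * ε ≤ 1 - κ * b / 2 - σ := by linarith
    have h3 : 5 * ε * (5 * ε) ≤ (1 - κ * b / 2 - σ - b) * (1 - κ * b / 2 - σ) :=
      mul_le_mul h1 h2 (by positivity) (by linarith)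
    have h4 : b * (b + 2) ≤ 3 * ε ^ 2 := by nlinarith
    have h5 : b ^ 3 ≤ κ * b / 2 * (2 * ε ^ 2) := by
      have : b ^ 2 ≤ κ * ε ^ 2 := by nlinarith
      nlinarith
    have e : 1 - κ * b / 2 - l = κ * b / 2 := by rw [hl]; ring
    simp only [F, e]
    have h6 : 0 ≤ κ * b / 2 * ((1 - κ * b / 2 - σ - b) * (1 - κ * b / 2 - σ)
        - b * (b + 2) - 2 * ε ^ 2) :=
      mul_nonneg (by linarith) (by nlinarith [sq_nonneg ε])
    nlinarith
  have hFc : Continuous F := by fun_prop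
  obtain ⟨r, ⟨hr1, hr2⟩, hr⟩ := intermediate_value_Icc (a := l) (b := 1 - κ * b / 2)
    (by rw [hl]; linarith) hFc.continuousOn ⟨hF0, hF1⟩
  simp only [F] at hr
  have hrl : l < r := by
    refine lt_of_le_of_ne hr1 fun h => ?_
    rw [← h, sub_self] at hr
    have : 0 < b ^ 3 := by positivity
    linarith
  have hrl' : 0 < r - l := by linarith
  have hrσ : 0 < r - σ := by linarith
  refine ⟨r, ![(r - σ) / η, 1, b / (r - l)], ?_, ?_, by linarith, hr2⟩
  · intro i
    fin_cases i
    · exact div_pos hrσ hη0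
    · exact one_pos
    · exact div_pos hb0 hrl'
  · have hne := hrl'.ne'
    have hη' := hη0.ne'
    ext i
    fin_cases i
    · simp only [Gmat, hlam, Matrix.mulVec, dotProduct, Fin.sum_univ_three, Pi.smul_apply,
        smul_eq_mul, Fin.zero_eta, Fin.isValue, Matrix.of_apply, Matrix.cons_val',
        Matrix.cons_val_zero, Matrix.cons_val_one, Matrix.cons_val, mul_one]
      have e : b * (b + 2) + b ^ 3 / (r - l) = (r - σ - b) * (r - σ) := by
        field_simp
        linarith
      have e2 : β = b / η := by rw [← hβη]; field_simp
      rw [hβη, mul_comm η β, hβη, e2]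
      field_simp
      field_simp at e
      linarith
    · simp [Gmat, hlam, Matrix.mulVec, dotProduct, Fin.sum_univ_three]
      field_simp
      ring
    · simp [Gmat, hlam, Matrix.mulVec, dotProduct, Fin.sum_univ_three]
      rw [mul_comm η β, hβη]
      field_simp
      ring

/-! ### Sublinear convergence for convex objectives -/

/-- Square summability of the consensus error, from the Lyapunov function
`δ² + (τ² / 24) a²`, which loses `(τ / 2) δ²` in each step up to the forcing term. -/
theorem sum_sq_le_of_linear_recursion {δ a h : ℕ → ℝ} {τ b : ℝ} (hδ : ∀ t, 0 ≤ δ t)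
    (ha : ∀ t, 0 ≤ a t) (hτ0 : 0 < τ) (hτ1 : τ ≤ 1) (hb0 : 0 ≤ b)
    (hb : b ≤ τ ^ 2 / 160) (hδs : ∀ t, δ (t + 1) ≤ (1 - τ) * δ t + b * a t)
    (has : ∀ t, a (t + 1) ≤ (1 - τ + b) * a t + 2 * δ t + h t) (T : ℕ) :
    ∑ k ∈ Finset.range (T + 1), δ k ^ 2
      ≤ (a 0 + 2 * δ 0) ^ 2 / (2 * τ) + 1 / 4 * ∑ k ∈ Finset.range T, h k ^ 2 := by
  -- Convexity of the square, used to square a recursion with contraction factor `1 - τ`.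
  have hsq : ∀ u p : ℝ, ((1 - τ) * u + p) ^ 2 ≤ (1 - τ) * u ^ 2 + p ^ 2 / τ := by
    intro u p
    have e : (1 - τ) * u ^ 2 + p ^ 2 / τ - ((1 - τ) * u + p) ^ 2
        = (1 - τ) * (τ * u - p) ^ 2 / τ := by
      field_simp
      ring
    have : 0 ≤ (1 - τ) * (τ * u - p) ^ 2 / τ :=
      div_nonneg (mul_nonneg (by linarith) (sq_nonneg _)) hτ0.le
    linarith
  have hstep : ∀ t, δ (t + 1) ^ 2 + τ ^ 2 / 24 * a (t + 1) ^ 2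
      ≤ δ t ^ 2 + τ ^ 2 / 24 * a t ^ 2 - τ / 2 * δ t ^ 2 + τ / 8 * h t ^ 2 := by
    intro t
    have h1 : δ (t + 1) ^ 2 ≤ (1 - τ) * δ t ^ 2 + (b * a t) ^ 2 / τ :=
      (pow_le_pow_left₀ (hδ _) (hδs t) 2).trans (hsq _ _)
    have h2 : a (t + 1) ^ 2 ≤ (1 - τ) * a t ^ 2 + (b * a t + 2 * δ t + h t) ^ 2 / τ := by
      refine (pow_le_pow_left₀ (ha _) ((has t).trans (le_of_eq ?_)) 2).trans (hsq _ _)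
      ring
    have h3 : (b * a t + 2 * δ t + h t) ^ 2
        ≤ 3 * (b ^ 2 * a t ^ 2 + 4 * δ t ^ 2 + h t ^ 2) := by
      nlinarith [sq_nonneg (b * a t - 2 * δ t), sq_nonneg (b * a t - h t),
        sq_nonneg (2 * δ t - h t)]
    have h4 : τ ^ 2 / 24 * ((b * a t + 2 * δ t + h t) ^ 2 / τ)
        ≤ τ / 8 * (b ^ 2 * a t ^ 2 + 4 * δ t ^ 2 + h t ^ 2) := by
      rw [show τ ^ 2 / 24 * ((b * a t + 2 * δ t + h t) ^ 2 / τ)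
        = τ / 24 * (b * a t + 2 * δ t + h t) ^ 2 by field_simp]
      have := mul_le_mul_of_nonneg_left h3 (show 0 ≤ τ / 24 by positivity)
      linarith
    have hb2 : b ^ 2 ≤ τ ^ 4 / 160 ^ 2 := by
      have := pow_le_pow_left₀ hb0 hb 2
      rw [div_pow, ← pow_mul] at this
      exact this
    have h5 : (b * a t) ^ 2 / τ ≤ τ ^ 3 / 160 ^ 2 * a t ^ 2 := by
      rw [div_le_iff₀ hτ0, mul_pow]
      have := mul_le_mul_of_nonneg_right hb2 (sq_nonneg (a t))
      linarith
    have h6 : τ / 8 * (b ^ 2 * a t ^ 2) ≤ τ ^ 3 / 160 ^ 2 * a t ^ 2 := by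
      have h61 : τ ^ 4 ≤ τ ^ 2 := pow_le_pow_of_le_one hτ0.le hτ1 (by norm_num)
      have h62 : τ / 8 * b ^ 2 ≤ τ / 8 * (τ ^ 2 / 160 ^ 2) :=
        mul_le_mul_of_nonneg_left (by linarith) (by positivity)
      have h63 : τ / 8 * b ^ 2 ≤ τ ^ 3 / 160 ^ 2 := by
        have : 0 < τ ^ 3 := by positivity
        linarith
      rw [← mul_assoc]
      exact mul_le_mul_of_nonneg_right h63 (sq_nonneg _)
    have h7 := mul_le_mul_of_nonneg_left h2 (show 0 ≤ τ ^ 2 / 24 by positivity)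
    have h8 : 0 ≤ τ ^ 3 * a t ^ 2 := by positivity
    linarith
  have htel : ∀ T, δ T ^ 2 + τ ^ 2 / 24 * a T ^ 2 + τ / 2 * ∑ k ∈ Finset.range T, δ k ^ 2
      ≤ δ 0 ^ 2 + τ ^ 2 / 24 * a 0 ^ 2 + τ / 8 * ∑ k ∈ Finset.range T, h k ^ 2 := by
    intro T
    induction T with
    | zero => simp
    | succ T ih =>
      rw [Finset.sum_range_succ, Finset.sum_range_succ]
      have := hstep T
      linarith
  have h1 := htel T
  have h2 : 0 ≤ τ ^ 2 / 24 * a T ^ 2 := by positivity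
  have h3 : τ / 2 * δ T ^ 2 ≤ δ T ^ 2 := by nlinarith [sq_nonneg (δ T)]
  have h4 : δ 0 ^ 2 + τ ^ 2 / 24 * a 0 ^ 2 ≤ (a 0 + 2 * δ 0) ^ 2 / 4 := by
    have h41 : τ ^ 2 * a 0 ^ 2 ≤ 1 * a 0 ^ 2 :=
      mul_le_mul_of_nonneg_right (by nlinarith) (sq_nonneg _)
    nlinarith [mul_nonneg (ha 0) (hδ 0), sq_nonneg (a 0)]
  have h5 : τ / 2 * ∑ k ∈ Finset.range (T + 1), δ k ^ 2
      ≤ τ / 2 * ((a 0 + 2 * δ 0) ^ 2 / (2 * τ) + 1 / 4 * ∑ k ∈ Finset.range T, h k ^ 2) := by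
    have e : τ / 2 * ((a 0 + 2 * δ 0) ^ 2 / (2 * τ) + 1 / 4 * ∑ k ∈ Finset.range T, h k ^ 2)
        = (a 0 + 2 * δ 0) ^ 2 / 4 + τ / 8 * ∑ k ∈ Finset.range T, h k ^ 2 := by
      field_simp
      ring
    rw [e, Finset.sum_range_succ]
    linarith
  exact le_of_mul_le_mul_left h5 (by positivity)

section Descent

variable {n N : ℕ} {W : Matrix (Fin n) (Fin n) ℝ} {f : Fin n → EuclideanSpace ℝ (Fin N) → ℝ}
  {β η : ℝ} {x0 : Fin n → EuclideanSpace ℝ (Fin N)} {xstar : EuclideanSpace ℝ (Fin N)}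

/-- The averaged gradient is an inexact gradient of the objective, whose error is controlled by
the disagreement of the points at which the local gradients are taken. -/
theorem objective_sub_le_inner_avg (hn : 0 < n) (hβ : 0 ≤ β)
    (hconv : ∀ i, ConvexOn ℝ univ (f i)) (hf : ∀ i, IsSmooth β (f i))
    (x : Fin n → EuclideanSpace ℝ (Fin N)) (y z : EuclideanSpace ℝ (Fin N)) :
    objective f y - objective f z ≤ inner ℝ (avg fun i => gradient (f i) (x i)) (y - z)
      + β * ‖y - avg x‖ ^ 2 + β / n * frob (fun i => x i - avg x) ^ 2 := by
  have hn' : (n : ℝ) ≠ 0 := by exact_mod_cast hn.ne'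
  have h1 : ∀ i, f i y - f i z ≤ inner ℝ (gradient (f i) (x i)) (y - z)
      + β * (‖y - avg x‖ ^ 2 + ‖x i - avg x‖ ^ 2) := by
    intro i
    have hup := le_add_inner_gradient_add_sq (hf i).1 (hf i).2 (x i) y
    have hlow := add_inner_gradient_le_of_convexOn (hconv i) (hf i).1 (x i) z
    have e : y - x i = (y - z) + (z - x i) := by abel
    have e2 : y - x i = (y - avg x) - (x i - avg x) := by abel
    have hq : ‖y - x i‖ ^ 2 ≤ 2 * (‖y - avg x‖ ^ 2 + ‖x i - avg x‖ ^ 2) := by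
      have := parallelogram_law_with_norm ℝ (y - avg x) (x i - avg x)
      rw [← e2] at this
      have := sq_nonneg ‖y - avg x + (x i - avg x)‖
      linarith
    have h2 : inner ℝ (gradient (f i) (x i)) (y - x i)
        = inner ℝ (gradient (f i) (x i)) (y - z) + inner ℝ (gradient (f i) (x i)) (z - x i) := by
      rw [e, inner_add_right]
    have := mul_le_mul_of_nonneg_left hq hβ
    linarith
  have h2 := Finset.sum_le_sum fun i (_ : i ∈ Finset.univ) => h1 i
  simp only [Finset.sum_sub_distrib, Finset.sum_add_distrib, ← Finset.mul_sum, Finset.sum_const,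
    Finset.card_univ, Fintype.card_fin, nsmul_eq_mul, ← sum_inner, ← frob_sq] at h2
  have h3 := mul_le_mul_of_nonneg_left h2 (show 0 ≤ 1 / (n : ℝ) by positivity)
  rw [avg, inner_smul_left, RCLike.conj_to_real]
  simp only [objective]
  refine le_trans (le_of_eq (by ring)) (h3.trans (le_of_eq ?_))
  rw [avg]
  field_simp
  ring

/-- Averaging the objective over the agents costs only a second-order term in the disagreement. -/
theorem sum_objective_le (hn : 0 < n) (hf : ∀ i, IsSmooth β (f i))
    (x : Fin n → EuclideanSpace ℝ (Fin N)) :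
    1 / (n : ℝ) * ∑ i, objective f (x i)
      ≤ objective f (avg x) + β / (2 * n) * frob (fun i => x i - avg x) ^ 2 := by
  have hn' : (n : ℝ) ≠ 0 := by exact_mod_cast hn.ne'
  have hs := isSmooth_objective hn hf
  have h1 := Finset.sum_le_sum fun i (_ : i ∈ Finset.univ) =>
    le_add_inner_gradient_add_sq hs.1 hs.2 (avg x) (x i)
  have h0 : ∑ i, (x i - avg x) = 0 := by
    rw [Finset.sum_sub_distrib, sum_eq_smul_avg x hn]
    simp [← Nat.cast_smul_eq_nsmul ℝ]
  simp only [Finset.sum_add_distrib, ← Finset.mul_sum, Finset.sum_const, Finset.card_univ,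
    Fintype.card_fin, nsmul_eq_mul, ← inner_sum, ← frob_sq, h0, inner_zero_right] at h1
  have h3 := mul_le_mul_of_nonneg_left h1 (show 0 ≤ 1 / (n : ℝ) by positivity)
  refine h3.trans (le_of_eq ?_)
  field_simp
  ring

/-- The inexact gradient inequality for one step, with the distance to the minimizer in telescoping
form. -/
theorem objective_xBar_succ_sub_le (hn : 0 < n) (hsymm : ∀ i j, W i j = W j i)
    (hrow : ∀ i, ∑ j, W i j = 1) (hβ : 0 ≤ β) (hη : 0 < η)
    (hconv : ∀ i, ConvexOn ℝ univ (f i)) (hf : ∀ i, IsSmooth β (f i)) (t : ℕ) :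
    objective f (xBar W f η x0 (t + 1)) - objective f xstar
      ≤ (‖xBar W f η x0 t - xstar‖ ^ 2 - ‖xBar W f η x0 (t + 1) - xstar‖ ^ 2) / (2 * η)
        - η * (1 / 2 - β * η) * ‖gAvg W f η x0 t‖ ^ 2 + β / n * consErr W f η x0 t ^ 2 := by
  have h := objective_sub_le_inner_avg hn hβ hconv hf (xIter W f η x0 t)
    (xBar W f η x0 (t + 1)) xstar
  have e1 : xBar W f η x0 (t + 1) - avg (xIter W f η x0 t) = - (η • gAvg W f η x0 t) := by
    rw [xBar_succ hsymm hrow, xBar]; abel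
  have e2 : xBar W f η x0 (t + 1) - xstar
      = (xBar W f η x0 t - xstar) - η • gAvg W f η x0 t := by
    rw [xBar_succ hsymm hrow]; abel
  have e3 : (avg fun i => gradient (f i) (xIter W f η x0 t i)) = gAvg W f η x0 t := rfl
  have e4 : frob (fun i => xIter W f η x0 t i - avg (xIter W f η x0 t))
      = consErr W f η x0 t := rfl
  rw [e1, e2, e3, e4, norm_neg, norm_smul, mul_pow, Real.norm_eq_abs, sq_abs, inner_sub_right,
    inner_smul_right, real_inner_self_eq_norm_sq] at h
  rw [e2, norm_sub_sq_real (xBar W f η x0 t - xstar), inner_smul_right, norm_smul, mul_pow,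
    Real.norm_eq_abs, sq_abs, real_inner_comm]
  refine h.trans (le_of_eq ?_)
  field_simp
  ring

theorem sum_objective_xBar_sub_le (hn : 0 < n) (hsymm : ∀ i j, W i j = W j i)
    (hrow : ∀ i, ∑ j, W i j = 1) (hβ : 0 ≤ β) (hη : 0 < η)
    (hconv : ∀ i, ConvexOn ℝ univ (f i)) (hf : ∀ i, IsSmooth β (f i)) (T : ℕ) :
    ∑ k ∈ Finset.range T, (objective f (xBar W f η x0 (k + 1)) - objective f xstar)
      ≤ ‖xBar W f η x0 0 - xstar‖ ^ 2 / (2 * η)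
        - η * (1 / 2 - β * η) * ∑ k ∈ Finset.range T, ‖gAvg W f η x0 k‖ ^ 2
        + β / n * ∑ k ∈ Finset.range T, consErr W f η x0 k ^ 2 := by
  have h := Finset.sum_le_sum fun k (_ : k ∈ Finset.range T) =>
    objective_xBar_succ_sub_le (x0 := x0) (xstar := xstar) hn hsymm hrow hβ hη hconv hf k
  rw [Finset.sum_add_distrib, Finset.sum_sub_distrib, Finset.sum_sub_distrib, ← Finset.mul_sum,
    ← Finset.mul_sum, ← Finset.sum_div,
    Finset.sum_range_sub' (fun k => ‖xBar W f η x0 k - xstar‖ ^ 2)] at h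
  rw [Finset.sum_sub_distrib]
  have h2 : (‖xBar W f η x0 0 - xstar‖ ^ 2 - ‖xBar W f η x0 T - xstar‖ ^ 2) / (2 * η)
      ≤ ‖xBar W f η x0 0 - xstar‖ ^ 2 / (2 * η) := by
    gcongr
    exact sub_le_self _ (sq_nonneg _)
  linarith

/-- The accumulated consensus error, up to a small multiple of the accumulated squared gradients. -/
theorem sum_consErr_sq_le (hn : 0 < n) (hsymm : ∀ i j, W i j = W j i)
    (hrow : ∀ i, ∑ j, W i j = 1) (hσ : sigma W < 1) (hβ : 0 < β) (hη : 0 < η)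
    (hηβ : β * η ≤ (1 - sigma W) ^ 2 / 160) (hf : ∀ i, IsSmooth β (f i)) (T : ℕ) :
    ∑ k ∈ Finset.range (T + 1), consErr W f η x0 k ^ 2
      ≤ (1 / β * gradErr W f η x0 0 + 2 * consErr W f η x0 0) ^ 2 / (2 * (1 - sigma W))
        + 1 / 4 * (η ^ 2 * n) * ∑ k ∈ Finset.range T, ‖gAvg W f η x0 k‖ ^ 2 := by
  have hσ0 : 0 ≤ sigma W := norm_nonneg _
  have h := sum_sq_le_of_linear_recursion (δ := consErr W f η x0)
    (a := fun t => 1 / β * gradErr W f η x0 t)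
    (h := fun t => η * (Real.sqrt n * ‖gAvg W f η x0 t‖)) (τ := 1 - sigma W) (b := β * η)
    (fun t => frob_nonneg _)
    (fun t => mul_nonneg (by positivity) (frob_nonneg _))
    (by linarith) (by linarith) (by positivity) hηβ
    (fun t => by
      have := consErr_succ_le (f := f) (x0 := x0) hn hsymm hrow hη.le t
      refine this.trans (le_of_eq ?_)
      field_simp
      ring)
    (fun t => by
      have := gradErr_succ_le (x0 := x0) hn hsymm hrow hσ.le hη.le hβ.le hf t
      have := mul_le_mul_of_nonneg_left this (show 0 ≤ 1 / β by positivity)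
      refine this.trans (le_of_eq ?_)
      field_simp
      ring) T
  refine h.trans (le_of_eq ?_)
  simp only [mul_pow, Real.sq_sqrt (Nat.cast_nonneg n), ← Finset.mul_sum]
  ring

/-- Jensen's inequality for the running averages. -/
theorem objective_xHatSucc_sub_le (hconv : ∀ i, ConvexOn ℝ univ (f i)) (t : ℕ) (i : Fin n) :
    objective f (xHatSucc W f η x0 t i) - objective f xstar
      ≤ 1 / ((t : ℝ) + 1) * ∑ k ∈ Finset.range (t + 1),
        (objective f (xIter W f η x0 (k + 1) i) - objective f xstar) := by
  have h := (convexOn_objective hconv).map_sum_le (t := Finset.range (t + 1))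
    (w := fun _ => 1 / ((t : ℝ) + 1)) (p := fun k => xIter W f η x0 (k + 1) i)
    (fun _ _ => by positivity)
    (by
      have : (t : ℝ) + 1 ≠ 0 := by positivity
      simp [this])
    (fun _ _ => mem_univ _)
  rw [← Finset.smul_sum] at h
  simp only [smul_eq_mul, ← Finset.mul_sum] at h
  rw [Finset.sum_sub_distrib, Finset.sum_const, Finset.card_range, nsmul_eq_mul, mul_sub]
  have e : 1 / ((t : ℝ) + 1) * (((t + 1 : ℕ) : ℝ) * objective f xstar) = objective f xstar := by
    push_cast
    field_simp
  rw [e, xHatSucc]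
  linarith

/-- Sublinear convergence of the running averages, averaged over the agents. -/
theorem avg_objective_xHatSucc_sub_le (hn : 0 < n) (hsymm : ∀ i j, W i j = W j i)
    (hrow : ∀ i, ∑ j, W i j = 1) (hσ : sigma W < 1) (hβ : 0 < β) (hη : 0 < η)
    (hηβ : β * η ≤ (1 - sigma W) ^ 2 / 160) (hconv : ∀ i, ConvexOn ℝ univ (f i))
    (hf : ∀ i, IsSmooth β (f i)) (t : ℕ) :
    1 / (n : ℝ) * ∑ i, (objective f (xHatSucc W f η x0 t i) - objective f xstar)
      ≤ 1 / ((t : ℝ) + 1) * (‖xBar W f η x0 0 - xstar‖ ^ 2 / (2 * η)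
        + 36 * β / (1 - sigma W) ^ 2 *
          ((1 / β * gradErr W f η x0 0 + 2 * consErr W f η x0 0) ^ 2 / n)) := by
  have hn' : (0 : ℝ) < n := by exact_mod_cast hn
  have hσ0 : 0 ≤ sigma W := norm_nonneg _
  obtain ⟨τ, hτ⟩ : ∃ τ, τ = 1 - sigma W := ⟨_, rfl⟩
  have hτ0 : 0 < τ := by linarith
  have hτ1 : τ ≤ 1 := by linarith
  have hb : β * η ≤ 1 / 160 := by
    rw [← hτ] at hηβ
    nlinarith
  have hC := sum_consErr_sq_le (x0 := x0) hn hsymm hrow hσ hβ hη hηβ hf (t + 1)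
  have hS := sum_objective_xBar_sub_le (x0 := x0) (xstar := xstar) hn hsymm hrow hβ.le hη hconv hf
    (t + 1)
  rw [← hτ] at hC ⊢
  set I := (1 / β * gradErr W f η x0 0 + 2 * consErr W f η x0 0) ^ 2
  set Γ := ∑ k ∈ Finset.range (t + 1), ‖gAvg W f η x0 k‖ ^ 2
  set D := ∑ k ∈ Finset.range (t + 1 + 1), consErr W f η x0 k ^ 2 with hD
  set P := ‖xBar W f η x0 0 - xstar‖ ^ 2 / (2 * η)
  have hD1 : ∑ k ∈ Finset.range (t + 1), consErr W f η x0 k ^ 2 ≤ D := by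
    rw [hD, Finset.sum_range_succ _ (t + 1)]
    exact le_add_of_nonneg_right (sq_nonneg _)
  have hD2 : ∑ k ∈ Finset.range (t + 1), consErr W f η x0 (k + 1) ^ 2 ≤ D := by
    rw [hD, Finset.sum_range_succ' _ (t + 1)]
    exact le_add_of_nonneg_right (sq_nonneg _)
  have hΓ : 0 ≤ Γ := Finset.sum_nonneg fun _ _ => sq_nonneg _
  have hI : 0 ≤ I := sq_nonneg _
  have hmean : ∑ k ∈ Finset.range (t + 1),
      1 / (n : ℝ) * ∑ i, (objective f (xIter W f η x0 (k + 1) i) - objective f xstar)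
      ≤ P - η * (1 / 2 - β * η) * Γ + β / n * D + β / (2 * n) * D := by
    have h1 : ∀ k, 1 / (n : ℝ) *
        ∑ i, (objective f (xIter W f η x0 (k + 1) i) - objective f xstar)
        ≤ (objective f (xBar W f η x0 (k + 1)) - objective f xstar)
          + β / (2 * n) * consErr W f η x0 (k + 1) ^ 2 := by
      intro k
      have := sum_objective_le hn hf (xIter W f η x0 (k + 1))
      rw [Finset.sum_sub_distrib, mul_sub]
      simp only [Finset.sum_const, Finset.card_univ, Fintype.card_fin, nsmul_eq_mul]
      rw [← mul_assoc, one_div_mul_cancel hn'.ne', one_mul]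
      simp only [consErr, xBar] at *
      linarith
    have h2 := Finset.sum_le_sum fun k (_ : k ∈ Finset.range (t + 1)) => h1 k
    rw [Finset.sum_add_distrib, ← Finset.mul_sum (Finset.range (t + 1))
      (fun k => consErr W f η x0 (k + 1) ^ 2)] at h2
    have h3 := mul_le_mul_of_nonneg_left hD1 (show 0 ≤ β / n by positivity)
    have h4 := mul_le_mul_of_nonneg_left hD2 (show 0 ≤ β / (2 * n) by positivity)
    linarith
  have hfinal : P - η * (1 / 2 - β * η) * Γ + β / n * D + β / (2 * n) * D
      ≤ P + 36 * β / τ ^ 2 * (I / n) := by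
    have h1 := mul_le_mul_of_nonneg_left hC (show 0 ≤ 3 * β / (2 * n) by positivity)
    have e1 : β / n * D + β / (2 * n) * D = 3 * β / (2 * n) * D := by
      field_simp
      ring
    have e2 : 3 * β / (2 * n) * (I / (2 * τ) + 1 / 4 * (η ^ 2 * n) * Γ)
        = 3 / 4 / τ * (β * (I / n)) + 3 / 8 * (β * η) * (η * Γ) := by
      field_simp
      ring
    have h2 : 3 / 4 / τ * (β * (I / n)) ≤ 36 / τ ^ 2 * (β * (I / n)) := by
      refine mul_le_mul_of_nonneg_right ?_ (by positivity)
      rw [div_le_div_iff₀ hτ0 (by positivity)]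
      nlinarith
    have h3 : 3 / 8 * (β * η) * (η * Γ) ≤ (1 / 2 - β * η) * (η * Γ) :=
      mul_le_mul_of_nonneg_right (by linarith) (by positivity)
    have e3 : 36 * β / τ ^ 2 * (I / n) = 36 / τ ^ 2 * (β * (I / n)) := by ring
    rw [e3]
    linarith
  calc _ ≤ 1 / (n : ℝ) * ∑ i, (1 / ((t : ℝ) + 1) * ∑ k ∈ Finset.range (t + 1),
        (objective f (xIter W f η x0 (k + 1) i) - objective f xstar)) := by
        gcongr with i
        exact objective_xHatSucc_sub_le hconv t i
    _ = 1 / ((t : ℝ) + 1) * ∑ k ∈ Finset.range (t + 1),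
        1 / (n : ℝ) * ∑ i, (objective f (xIter W f η x0 (k + 1) i) - objective f xstar) := by
        rw [← Finset.mul_sum, ← Finset.mul_sum, Finset.sum_comm]
        ring
    _ ≤ _ := by
        gcongr
        exact hmean.trans hfinal

/-- Summability of the squared consensus errors in the convex case. -/
theorem sum_consErr_sq_le_of_minimizer (hn : 0 < n) (hsymm : ∀ i j, W i j = W j i)
    (hrow : ∀ i, ∑ j, W i j = 1) (hσ : sigma W < 1) (hβ : 0 < β) (hη : 0 < η)
    (hηβ : β * η ≤ (1 - sigma W) ^ 2 / 160) (hconv : ∀ i, ConvexOn ℝ univ (f i))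
    (hf : ∀ i, IsSmooth β (f i)) (hxstar : ∀ y, objective f xstar ≤ objective f y) (t : ℕ) :
    ∑ k ∈ Finset.range (t + 1), consErr W f η x0 k ^ 2
      ≤ 1740 / (1 - sigma W) ^ 4 *
          (1 / β * gradErr W f η x0 0 + 2 * consErr W f η x0 0) ^ 2
        + 24 / (1 - sigma W) ^ 2 * (n * ‖xBar W f η x0 0 - xstar‖ ^ 2) := by
  have hn' : (0 : ℝ) < n := by exact_mod_cast hn
  have hσ0 : 0 ≤ sigma W := norm_nonneg _
  obtain ⟨τ, hτ⟩ : ∃ τ, τ = 1 - sigma W := ⟨_, rfl⟩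
  have hτ0 : 0 < τ := by linarith
  have hτ1 : τ ≤ 1 := by linarith
  have hb : β * η ≤ 1 / 160 := by
    rw [← hτ] at hηβ
    nlinarith
  have hC := sum_consErr_sq_le (x0 := x0) hn hsymm hrow hσ hβ hη hηβ hf t
  have hS := sum_objective_xBar_sub_le (x0 := x0) (xstar := xstar) hn hsymm hrow hβ.le hη hconv hf t
  have hS0 : 0 ≤ ∑ k ∈ Finset.range t,
      (objective f (xBar W f η x0 (k + 1)) - objective f xstar) :=
    Finset.sum_nonneg fun k _ => sub_nonneg.2 (hxstar _)
  rw [← hτ] at hC ⊢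
  set I := (1 / β * gradErr W f η x0 0 + 2 * consErr W f η x0 0) ^ 2
  set Γ := ∑ k ∈ Finset.range t, ‖gAvg W f η x0 k‖ ^ 2
  set D := ∑ k ∈ Finset.range (t + 1), consErr W f η x0 k ^ 2 with hD
  set P := ‖xBar W f η x0 0 - xstar‖ ^ 2
  have hI : 0 ≤ I := sq_nonneg _
  have hP : 0 ≤ P := sq_nonneg _
  have hΓ : 0 ≤ Γ := Finset.sum_nonneg fun _ _ => sq_nonneg _
  have hD0 : 0 ≤ D := Finset.sum_nonneg fun _ _ => sq_nonneg _
  have hD1 : ∑ k ∈ Finset.range t, consErr W f η x0 k ^ 2 ≤ D := by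
    rw [hD, Finset.sum_range_succ]
    exact le_add_of_nonneg_right (sq_nonneg _)
  clear_value I Γ D P
  -- The accumulated gradients are controlled by the nonnegativity of the suboptimality.
  have h1 : (1 / 2 - β * η) * (η ^ 2 * n * Γ) ≤ n * P / 2 + β * η * D := by
    have h2 := mul_le_mul_of_nonneg_left hD1 (show 0 ≤ β / n by positivity)
    have h3 : 0 ≤ (η * n) * (P / (2 * η) - η * (1 / 2 - β * η) * Γ + β / n * D) :=
      mul_nonneg (by positivity) (by linarith)
    have e : (η * n) * (P / (2 * η) - η * (1 / 2 - β * η) * Γ + β / n * D)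
        = n * P / 2 + β * η * D - (1 / 2 - β * η) * (η ^ 2 * n * Γ) := by
      field_simp
      ring
    linarith
  have hX : 0 ≤ η ^ 2 * n * Γ := by positivity
  have h2 : 79 / 160 * (η ^ 2 * n * Γ) ≤ n * P / 2 + 1 / 160 * D := by
    have h3 := mul_le_mul_of_nonneg_right hb hD0
    have h4 := mul_le_mul_of_nonneg_right hb hX
    linarith
  have hnP : 0 ≤ n * P := by positivity
  have h5 : I / (2 * τ) ≤ 1 / τ ^ 4 * I := by
    rw [div_eq_mul_one_div, mul_comm]
    refine mul_le_mul_of_nonneg_right ?_ hI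
    have : τ ^ 4 ≤ τ := by
      simpa using pow_le_pow_of_le_one hτ0.le hτ1 (show 1 ≤ 4 by norm_num)
    exact one_div_le_one_div_of_le (by positivity) (by linarith)
  have h6 : 1 * (n * P) ≤ 1 / τ ^ 2 * (n * P) := by
    refine mul_le_mul_of_nonneg_right ?_ hnP
    rw [le_div_iff₀ (by positivity), one_mul]
    exact pow_le_one₀ hτ0.le hτ1
  have h7 : 0 ≤ 1 / τ ^ 4 * I := by positivity
  have e1 : 1740 / τ ^ 4 * I = 1740 * (1 / τ ^ 4 * I) := by ring
  have e2 : 24 / τ ^ 2 * (n * P) = 24 * (1 / τ ^ 2 * (n * P)) := by ring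
  rw [e1, e2]
  linarith

end Descent

/-! ### Linear convergence for strongly convex objectives -/

/-- With at least one dimension, the strong convexity constant is at most the smoothness
constant. -/
theorem IsStronglyConvex.le_of_isSmooth {N : ℕ} (hN : 0 < N) {α β : ℝ}
    {φ : EuclideanSpace ℝ (Fin N) → ℝ} (hc : IsStronglyConvex α φ) (hs : IsSmooth β φ) :
    α ≤ β := by
  have h1 := hc 0 (EuclideanSpace.single ⟨0, hN⟩ 1)
  have h2 := le_add_inner_gradient_add_sq hs.1 hs.2 0 (EuclideanSpace.single ⟨0, hN⟩ 1)
  simp only [sub_zero, PiLp.norm_single, norm_one, one_pow, mul_one] at h1 h2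
  linarith

theorem Gmat_nonneg {σ α β η : ℝ} (hσ : 0 ≤ σ) (hβ : 0 ≤ β) (hη : 0 ≤ η) (i j : Fin 3) :
    0 ≤ Gmat σ α β η i j := by
  have h1 : 0 ≤ max |1 - α * η| |1 - β * η| := le_max_of_le_left (abs_nonneg _)
  fin_cases i <;> fin_cases j <;> simp [Gmat] <;> positivity

section StronglyConvex

variable {n N : ℕ} {W : Matrix (Fin n) (Fin n) ℝ} {f : Fin n → EuclideanSpace ℝ (Fin N) → ℝ}
  {α β η : ℝ} {x0 : Fin n → EuclideanSpace ℝ (Fin N)} {xstar : EuclideanSpace ℝ (Fin N)}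

/-- The error vector of the method: gradient tracking error, consensus error, and distance of the
average to the minimizer. -/
def errVec (W : Matrix (Fin n) (Fin n) ℝ) (f : Fin n → EuclideanSpace ℝ (Fin N) → ℝ) (η : ℝ)
    (x0 : Fin n → EuclideanSpace ℝ (Fin N)) (xstar : EuclideanSpace ℝ (Fin N)) (t : ℕ) :
    Fin 3 → ℝ :=
  ![gradErr W f η x0 t, consErr W f η x0 t, Real.sqrt n * ‖xBar W f η x0 t - xstar‖]

theorem errVec_succ_le (hn : 0 < n) (hsymm : ∀ i j, W i j = W j i)
    (hrow : ∀ i, ∑ j, W i j = 1) (hσ : sigma W ≤ 1) (hη : 0 < η) (hβ : 0 ≤ β)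
    (hf : ∀ i, IsSmooth β (f i)) (hsc : ∀ i, IsStronglyConvex α (f i)) (hαβ : α ≤ β)
    (hη2 : η * (α + β) ≤ 2) (hxstar : ∀ y, objective f xstar ≤ objective f y) (t : ℕ)
    (i : Fin 3) : errVec W f η x0 xstar (t + 1) i
      ≤ (Gmat (sigma W) α β η).mulVec (errVec W f η x0 xstar t) i := by
  fin_cases i
  · have h1 := gradErr_succ_le (x0 := x0) hn hsymm hrow hσ hη.le hβ hf t
    have h2 := mul_le_mul_of_nonneg_left
      (sqrt_mul_norm_gAvg_le (W := W) (η := η) (x0 := x0) hn hβ hf hxstar t)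
      (mul_nonneg hβ hη.le)
    simp [errVec, Gmat, Matrix.mulVec, dotProduct, Fin.sum_univ_three]
    linarith
  · have h1 := consErr_succ_le (f := f) (x0 := x0) hn hsymm hrow hη.le t
    simp [errVec, Gmat, Matrix.mulVec, dotProduct, Fin.sum_univ_three]
    linarith
  · have h1 := sqrt_mul_norm_xBar_succ_sub_le (x0 := x0) hn hsymm hrow hη hβ hf hsc hαβ hη2
      hxstar t
    have h2 : |1 - α * η| * (Real.sqrt n * ‖xBar W f η x0 t - xstar‖)
        ≤ max |1 - α * η| |1 - β * η| * (Real.sqrt n * ‖xBar W f η x0 t - xstar‖) :=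
      mul_le_mul_of_nonneg_right (le_max_left _ _) (by positivity)
    simp [errVec, Gmat, Matrix.mulVec, dotProduct, Fin.sum_univ_three]
    linarith

/-- The gradient vanishes at the minimizer, so only the quadratic term of the upper bound is left. -/
theorem objective_sub_le_sq (hn : 0 < n) (hf : ∀ i, IsSmooth β (f i))
    (hxstar : ∀ y, objective f xstar ≤ objective f y) (y : EuclideanSpace ℝ (Fin N)) :
    objective f y - objective f xstar ≤ β / 2 * ‖y - xstar‖ ^ 2 := by
  have hs := isSmooth_objective hn hf
  have h := le_add_inner_gradient_add_sq hs.1 hs.2 xstar y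
  rw [gradient_objective_eq_zero hxstar, inner_zero_left] at h
  linarith

/-- Linear convergence, at exactly the rate given by the spectral radius of `G(η)`. -/
theorem linear_convergence (hN : 0 < N) (hn : 0 < n) (hsymm : ∀ i j, W i j = W j i)
    (hrow : ∀ i, ∑ j, W i j = 1) {ε : ℝ} (hε : 0 < ε) (hσ : sigma W ≤ 1 - 6 * ε)
    (hα : 0 < α) (hf : ∀ i, IsSmooth β (f i)) (hsc : ∀ i, IsStronglyConvex α (f i))
    (hxstar : ∀ y, objective f xstar ≤ objective f y) (hη : η = α / β ^ 2 * ε ^ 2) {ρ : ℝ}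
    (hρ : ρ = rho (Gmat (sigma W) α β η)) :
    ρ ≤ 1 - 1 / 2 * (α / β * ε) ^ 2 ∧
      ((fun t : ℕ => ‖xBar W f η x0 t - xstar‖) =O[atTop] fun t : ℕ => ρ ^ t) ∧
      ∀ i : Fin n,
        ((fun t : ℕ => ‖xIter W f η x0 t i - xBar W f η x0 t‖) =O[atTop] fun t : ℕ => ρ ^ t) ∧
        ((fun t : ℕ => ‖sIter W f η x0 t i - gAvg W f η x0 t‖) =O[atTop] fun t : ℕ => ρ ^ t) ∧
        ((fun t : ℕ => objective f (xIter W f η x0 t i) - objective f xstar)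
          =O[atTop] fun t : ℕ => ρ ^ (2 * t)) := by
  have hαβ : α ≤ β := (hsc ⟨0, hn⟩).le_of_isSmooth hN (hf ⟨0, hn⟩)
  have hβ : 0 < β := hα.trans_le hαβ
  have hσ0 : 0 ≤ sigma W := norm_nonneg _
  have hη0 : 0 < η := by rw [hη]; positivity
  have hη2 : η * (α + β) ≤ 2 := by
    have h1 : η * β ≤ 1 := by
      have e : η * β = α / β * ε ^ 2 := by rw [hη]; field_simp
      rw [e]
      exact mul_le_one₀ ((div_le_one hβ).2 hαβ) (sq_nonneg _) (pow_le_one₀ hε.le (by linarith))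
    have h2 : η * α ≤ η * β := mul_le_mul_of_nonneg_left hαβ hη0.le
    linarith
  obtain ⟨r, v, hv, hGv, hr0, hr⟩ := exists_pos_eigenvector_Gmat hα hαβ hε hσ hσ0 hη
  have hG := Gmat_nonneg (α := α) hσ0 hβ.le hη0.le
  have hρr : ρ = r := hρ.trans (rho_eq_of_pos_eigenvector hG hv hGv)
  rw [hρr]
  obtain ⟨C, hC⟩ := exists_le_mul_pow_of_le_mulVec hG hv hGv (z := errVec W f η x0 xstar)
    (errVec_succ_le hn hsymm hrow (by linarith) hη0 hβ.le hf hsc hαβ hη2 hxstar)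
  have hO : ∀ (u : ℕ → ℝ) (i : Fin 3), (∀ t, 0 ≤ u t) →
      (∀ t, u t ≤ errVec W f η x0 xstar t i) → u =O[atTop] fun t : ℕ => r ^ t := by
    intro u i hu0 hu
    refine IsBigO.of_bound (C * v i) (Eventually.of_forall fun t => ?_)
    rw [Real.norm_of_nonneg (hu0 t), Real.norm_of_nonneg (pow_nonneg hr0.le t)]
    exact ((hu t).trans (hC t i)).trans (le_of_eq (by ring))
  have hbar : (fun t : ℕ => ‖xBar W f η x0 t - xstar‖) =O[atTop] fun t : ℕ => r ^ t := by
    refine hO _ 2 (fun t => norm_nonneg _) fun t => ?_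
    have h1 : (1 : ℝ) ≤ Real.sqrt n := Real.one_le_sqrt.2 (by exact_mod_cast hn)
    exact le_mul_of_one_le_left (norm_nonneg _) h1
  refine ⟨hr, hbar, fun i => ?_⟩
  have hx : (fun t : ℕ => ‖xIter W f η x0 t i - xBar W f η x0 t‖) =O[atTop]
      fun t : ℕ => r ^ t := hO _ 1 (fun t => norm_nonneg _) fun t =>
    norm_le_frob (fun i => xIter W f η x0 t i - xBar W f η x0 t) i
  refine ⟨hx, hO _ 0 (fun t => norm_nonneg _) fun t =>
    norm_le_frob (fun i => sIter W f η x0 t i - gAvg W f η x0 t) i, ?_⟩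
  have hsum := (hx.add hbar).pow 2
  simp only [← pow_mul, mul_comm _ 2] at hsum
  refine IsBigO.trans (IsBigO.of_bound (β / 2) (Eventually.of_forall fun t => ?_)) hsum
  rw [Real.norm_of_nonneg (sub_nonneg.2 (hxstar _)), Real.norm_of_nonneg (sq_nonneg _)]
  refine (objective_sub_le_sq hn hf hxstar _).trans ?_
  gcongr
  exact norm_sub_le_norm_sub_add_norm_sub _ _ _

end StronglyConvex

end DistOpt
end

theorem mainTheorem5 (n N : ℕ) (hN : 0 < N)
    (𝒢 : SimpleGraph (Fin n)) [DecidableRel 𝒢.Adj] (h𝒢 : 𝒢.Connected)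
    (W : Matrix (Fin n) (Fin n) ℝ) (hW : W = DistOpt.lazyMetropolis 𝒢)
    (U : ℝ) (hU : (n : ℝ) ≤ U)
    (f : Fin n → EuclideanSpace ℝ (Fin N) → ℝ) (β : ℝ) (hβ : 0 < β)
    (hconv : ∀ i, ConvexOn ℝ Set.univ (f i)) (hsmooth : ∀ i, DistOpt.IsSmooth β (f i))
    (xstar : EuclideanSpace ℝ (Fin N))
    (hxstar : ∀ y, DistOpt.objective f xstar ≤ DistOpt.objective f y)
    (x0 : Fin n → EuclideanSpace ℝ (Fin N)) :
    (∀ α : ℝ, 0 < α → (∀ i, DistOpt.IsStronglyConvex α (f i)) →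
      ∀ η : ℝ, η = α / β ^ 2 * (1 / (426 * U ^ 2)) ^ 2 →
      ∀ ρ : ℝ, ρ = DistOpt.rho (DistOpt.Gmat (DistOpt.sigma W) α β η) →
        ρ ≤ 1 - 1 / 2 * (α / β * (1 / (426 * U ^ 2))) ^ 2 ∧
        ((fun t : ℕ => ‖DistOpt.xBar W f η x0 t - xstar‖) =O[atTop] fun t : ℕ => ρ ^ t) ∧
        ∀ i : Fin n,
          ((fun t : ℕ => ‖DistOpt.xIter W f η x0 t i - DistOpt.xBar W f η x0 t‖)
            =O[atTop] fun t : ℕ => ρ ^ t) ∧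
          ((fun t : ℕ => ‖DistOpt.sIter W f η x0 t i - DistOpt.gAvg W f η x0 t‖)
            =O[atTop] fun t : ℕ => ρ ^ t) ∧
          ((fun t : ℕ => DistOpt.objective f (DistOpt.xIter W f η x0 t i)
              - DistOpt.objective f xstar)
            =O[atTop] fun t : ℕ => ρ ^ (2 * t))) ∧
    (∀ η : ℝ, 0 < η → η ≤ 1 / (160 * β * (71 * U ^ 2) ^ 2) →
      ∀ σ : ℝ, σ = DistOpt.sigma W →
        (∀ t : ℕ,
          1 / (n : ℝ) * ∑ i, (DistOpt.objective f (DistOpt.xHatSucc W f η x0 t i)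
              - DistOpt.objective f xstar)
            ≤ 1 / ((t : ℝ) + 1) *
              (‖DistOpt.xBar W f η x0 0 - xstar‖ ^ 2 / (2 * η)
                + 36 * β / (1 - σ) ^ 2 *
                  (1 / (β * Real.sqrt n) * DistOpt.gradErr W f η x0 0
                    + 2 / Real.sqrt n * DistOpt.consErr W f η x0 0) ^ 2)) ∧
        (∀ t : ℕ, 1 ≤ t →
          (Finset.range (t + 1)).inf' Finset.nonempty_range_add_one
              (fun k => DistOpt.consErr W f η x0 k ^ 2)
            ≤ 1 / (t : ℝ) *
              (1740 / (1 - σ) ^ 4 *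
                  (1 / β * DistOpt.gradErr W f η x0 0 + 2 * DistOpt.consErr W f η x0 0) ^ 2
                + 24 / (1 - σ) ^ 2 *
                  DistOpt.frob (fun _ : Fin n => DistOpt.xBar W f η x0 0 - xstar) ^ 2)) ∧
        (∀ (t : ℕ) (i : Fin n),
          DistOpt.objective f (DistOpt.xHatSucc W f η x0 t i) - DistOpt.objective f xstar
            ≤ 1 / ((t : ℝ) + 1) *
              (DistOpt.frob (fun _ : Fin n => DistOpt.xBar W f η x0 0 - xstar) ^ 2 / (2 * η)
                + 36 * β / (1 - σ) ^ 2 *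
                  (1 / β * DistOpt.gradErr W f η x0 0
                    + 2 * DistOpt.consErr W f η x0 0) ^ 2))) := by
  subst hW
  have hn : 0 < n := Fin.pos_iff_nonempty.2 h𝒢.nonempty
  have hn1 : (1 : ℝ) ≤ n := by exact_mod_cast hn
  have hU1 : 1 ≤ U := hn1.trans hU
  have hU0 : 0 < U ^ 2 := by positivity
  have hsymm := DistOpt.lazyMetropolis_isSymm 𝒢
  have hrow := DistOpt.lazyMetropolis_sum_row 𝒢
  have hgap : DistOpt.sigma (DistOpt.lazyMetropolis 𝒢) ≤ 1 - 1 / (71 * U ^ 2) := by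
    refine (DistOpt.sigma_lazyMetropolis_le h𝒢).trans (sub_le_sub_left ?_ 1)
    refine one_div_le_one_div_of_le (by positivity) ?_
    have : (n : ℝ) ^ 2 ≤ U ^ 2 := pow_le_pow_left₀ (by positivity) hU 2
    linarith
  refine ⟨fun α hα hsc η hη ρ hρ => ?_, fun η hη0 hη σ hσ => ?_⟩
  · refine DistOpt.linear_convergence hN hn hsymm hrow (by positivity) (hgap.trans (le_of_eq ?_))
      hα hsmooth hsc hxstar hη hρ
    field_simp
    ring
  · have hpos : 0 < 1 / (71 * U ^ 2) := by positivity
    have hσ1 : DistOpt.sigma (DistOpt.lazyMetropolis 𝒢) < 1 := by linarith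
    have hηβ : β * η ≤ (1 - DistOpt.sigma (DistOpt.lazyMetropolis 𝒢)) ^ 2 / 160 := by
      have h1 := mul_le_mul_of_nonneg_left hη hβ.le
      have h2 : (1 / (71 * U ^ 2)) ^ 2
          ≤ (1 - DistOpt.sigma (DistOpt.lazyMetropolis 𝒢)) ^ 2 :=
        pow_le_pow_left₀ hpos.le (by linarith) 2
      have e : β * (1 / (160 * β * (71 * U ^ 2) ^ 2)) = (1 / (71 * U ^ 2)) ^ 2 / 160 := by
        field_simp
      linarith
    rw [hσ]
    have hn' : (n : ℝ) ≠ 0 := by positivity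
    have hsqrt : Real.sqrt n ≠ 0 := by positivity
    have hmean := DistOpt.avg_objective_xHatSucc_sub_le (x0 := x0) (xstar := xstar) hn hsymm hrow
      hσ1 hβ hη0 hηβ hconv hsmooth
    refine ⟨fun t => ?_, fun t ht => ?_, fun t i => ?_⟩
    · refine (hmean t).trans (le_of_eq ?_)
      congr 3
      have e : ∀ a b : ℝ, (1 / (β * Real.sqrt n) * a + 2 / Real.sqrt n * b)
          = (1 / β * a + 2 * b) / Real.sqrt n := by
        intro a b
        field_simp
      rw [e, div_pow, Real.sq_sqrt (by positivity)]
    · have ht' : (0 : ℝ) < t := by exact_mod_cast ht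
      have hsum := DistOpt.sum_consErr_sq_le_of_minimizer (x0 := x0) hn hsymm hrow hσ1 hβ hη0 hηβ
        hconv hsmooth hxstar t
      rw [← DistOpt.frob_const_sq] at hsum
      rw [one_div, le_inv_mul_iff₀ ht']
      refine le_trans ?_ hsum
      set F : ℕ → ℝ := fun k => DistOpt.consErr (DistOpt.lazyMetropolis 𝒢) f η x0 k ^ 2
      have hle : ∀ k ∈ Finset.range (t + 1),
          (Finset.range (t + 1)).inf' Finset.nonempty_range_add_one F ≤ F k :=
        fun k hk => Finset.inf'_le _ hk
      have hcard := Finset.card_nsmul_le_sum _ _ _ hle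
      have hinf : 0 ≤ (Finset.range (t + 1)).inf' Finset.nonempty_range_add_one F :=
        Finset.le_inf' _ _ fun k _ => sq_nonneg _
      rw [Finset.card_range, nsmul_eq_mul] at hcard
      push_cast at hcard
      linarith
    · -- A single nonnegative summand is at most the sum over all agents.
      have hsingle := Finset.single_le_sum (f := fun j => DistOpt.objective f
          (DistOpt.xHatSucc (DistOpt.lazyMetropolis 𝒢) f η x0 t j) - DistOpt.objective f xstar)
        (fun j _ => sub_nonneg.2 (hxstar _)) (Finset.mem_univ i)
      have h := mul_le_mul_of_nonneg_left (hmean t) (Nat.cast_nonneg (α := ℝ) n)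
      rw [← mul_assoc, mul_one_div_cancel hn', one_mul] at h
      refine (hsingle.trans h).trans (le_of_eq ?_)
      rw [DistOpt.frob_const_sq]
      field_simp
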